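/- Let $p\ge 1$, and let $Y$ be a real random variable and $X$ a random vector in $\mathbb{R}^p$, defined on a common probability space, with $E(Y^2)<\infty$, $E(\|X\|^2)<\infty$, $V(Y)>0$ and $V(X)$ nonsingular. Assume that $E(Y\mid X)=\alpha_0+X'\beta_0$ almost surely for some $(\alpha_0,\beta_0)\in\mathbb{R}\times\mathbb{R}^p$. For an integrable random variable or vector $A$, write $A_0=A-E(A)$, and let $F_A$ be the cdf of a real random variable $A$. For a cdf $F$ on $\mathbb{R}$ let $F^{-1}(t)=\inf\{x: F(x)\ge t\}$. For cdfs $F,G$ with mean zero and $\alpha\in(0,1)$ let $$R(\alpha,F,G)=\frac{\int_\alpha^1F^{-1}(t)\,dt}{\int_\alpha^1G^{-1}(t)\,dt},\qquad S(F,G)=\inf_{\alpha\in(0,1)}R(\alpha,F,G).$$ For integrable real random variables $A,B$, say that $A$ dominates $B$ in the convex order if $E[\phi(A)]\ge E[\phi(B)]$ for every convex $\phi:\mathbb{R}\to\mathbb{R}$ (expectations taken in $(-\infty,+\infty]$). The sharp identified set of $\beta_0$ from the marginal distributions of $Y$ and $X$ is the set $\mathcal{B}$ of all $\beta\in\mathbb{R}^p$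 for which there exist random variables $\widetilde X,\widetilde Y$ on a common probability space such that $\widetilde X$ has the distribution of $X$, $\widetilde Y$ has the distribution of $Y$, and $E(\widetilde Y_0\mid\widetilde X_0)=\widetilde X_0'\beta$ almost surely. Then $$\mathcal{B}=\left\{\lambda q:\ q\in\mathbb{R}^p,\ \|q\|=1,\ 0\le\lambda\le S(F_{Y_0},F_{X_0'q})\right\}=\left\{\beta\in\mathbb{R}^p:\ Y_0\text{ dominates }X_0'\beta\text{ in the convex order}\right\}.$$ Moreover, $\mathcal{B}$ contains $0$, is convex and compact, and $\mathcal{B}\subseteq\{\beta\in\mathbb{R}^p:\ \beta'V(X)\beta\le V(Y)\}$. -/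

import Mathlib

open MeasureTheory ProbabilityTheory

noncomputable section

/-- The centered version `A₀ = A - E(A)` of an integrable random variable (or vector) `A`. -/
def centered {Ω : Type*} [MeasurableSpace Ω] {E : Type*} [NormedAddCommGroup E] [NormedSpace ℝ E]
    (P : Measure Ω) (A : Ω → E) : Ω → E :=
  fun ω => A ω - ∫ ω', A ω' ∂P

/-- The variance-covariance matrix `V(X)` of a random vector `X` in `ℝ^p`. -/
def covMatrix {Ω : Type*} [MeasurableSpace Ω] {p : ℕ}
    (P : Measure Ω) (X : Ω → EuclideanSpace ℝ (Fin p)) : Matrix (Fin p) (Fin p) ℝ :=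
  Matrix.of fun i j => covariance (fun ω => X ω i) (fun ω => X ω j) P

/-- The cdf `F_A` of a real random variable `A`. -/
def cdfOf {Ω : Type*} [MeasurableSpace Ω] (P : Measure Ω) (A : Ω → ℝ) : ℝ → ℝ :=
  fun x => cdf (P.map A) x

/-- The generalized inverse `F⁻¹(t) = inf {x : F(x) ≥ t}` of a cdf `F`. -/
def genInv (F : ℝ → ℝ) (t : ℝ) : ℝ :=
  sInf {x : ℝ | t ≤ F x}

/-- The ratio of superquantiles `R(α, F, G)`. -/
def superquantileRatio (α : ℝ) (F G : ℝ → ℝ) : ℝ :=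
  (∫ t in α..1, genInv F t) / (∫ t in α..1, genInv G t)

/-- `S(F, G) = inf_{α ∈ (0,1)} R(α, F, G)`. -/
def infRatio (F G : ℝ → ℝ) : ℝ :=
  ⨅ α : Set.Ioo (0 : ℝ) 1, superquantileRatio (α : ℝ) F G

/-- The expectation of `Z`, as an extended real number `E(Z⁺) - E(Z⁻)`; it may be `+∞`, and is
meaningful as soon as `E(Z⁻) < ∞`. -/
def extExpectation {Ω : Type*} [MeasurableSpace Ω] (P : Measure Ω) (Z : Ω → ℝ) : EReal :=
  ((∫⁻ ω, ENNReal.ofReal (Z ω) ∂P : ENNReal) : EReal) -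
    ((∫⁻ ω, ENNReal.ofReal (-Z ω) ∂P : ENNReal) : EReal)

/-- `A` dominates `B` in the convex order: both are integrable, and `E(φ(A)) ≥ E(φ(B))` for every
convex function `φ : ℝ → ℝ`, the expectations being taken in `(-∞, +∞]`. -/
def ConvexDominates {Ω : Type*} [MeasurableSpace Ω] (P : Measure Ω) (A B : Ω → ℝ) : Prop :=
  Integrable A P ∧ Integrable B P ∧
    ∀ φ : ℝ → ℝ, ConvexOn ℝ Set.univ φ →
      extExpectation P (fun ω => φ (B ω)) ≤ extExpectation P (fun ω => φ (A ω))

/-- The identified set of the slope coefficient, given the marginal laws `μY` of the outcome and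
`μX` of the covariates: all `β` for which there are random variables `X'`, `Y'` on a common
probability space with these marginal laws and with `E(Y'₀ | X'₀) = X'₀ ⬝ β` almost surely. -/
def identifiedSet {p : ℕ} (μY : Measure ℝ) (μX : Measure (EuclideanSpace ℝ (Fin p))) :
    Set (EuclideanSpace ℝ (Fin p)) :=
  {β | ∃ (Ω' : Type) (_ : MeasurableSpace Ω') (P' : Measure Ω')
      (X' : Ω' → EuclideanSpace ℝ (Fin p)) (Y' : Ω' → ℝ),
      IsProbabilityMeasure P' ∧ Measurable X' ∧ Measurable Y' ∧
      P'.map X' = μX ∧ P'.map Y' = μY ∧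
      P'[centered P' Y' | MeasurableSpace.comap (centered P' X') inferInstance]
        =ᵐ[P'] fun ω => inner ℝ (centered P' X' ω) β}

end

noncomputable section

section Quantile

open scoped Pointwise
open Set Filter Topology

variable {ν : Measure ℝ}

/-- The quantile function and the cdf form a Galois connection on the open unit interval. -/
theorem genInv_cdf_le_iff {t x : ℝ} (ht : t ∈ Ioo (0 : ℝ) 1) :
    genInv (cdf ν) t ≤ x ↔ t ≤ cdf ν x := by
  set S : Set ℝ := {x : ℝ | t ≤ cdf ν x} with hS
  have hne : S.Nonempty := by
    obtain ⟨y, hy⟩ := ((tendsto_cdf_atTop ν).eventually (lt_mem_nhds ht.2)).exists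
    exact ⟨y, hy.le⟩
  have hbdd : BddBelow S := by
    obtain ⟨y, hy⟩ := ((tendsto_cdf_atBot ν).eventually (gt_mem_nhds ht.1)).exists
    refine ⟨y, fun z hz => ?_⟩
    by_contra! hzy
    exact absurd (hz.trans (monotone_cdf ν hzy.le)) (not_le.2 hy)
  have hmem : sInf S ∈ S := by
    have hcont := (cdf ν).right_continuous (sInf S)
    have : Tendsto (cdf ν) (𝓝[>] sInf S) (𝓝 (cdf ν (sInf S))) :=
      hcont.mono_left (nhdsWithin_mono _ Ioi_subset_Ici_self)
    refine ge_of_tendsto this ?_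
    filter_upwards [self_mem_nhdsWithin] with z hz
    obtain ⟨w, hw, hwz⟩ := exists_lt_of_csInf_lt hne hz
    exact le_trans hw (monotone_cdf ν hwz.le)
  exact ⟨fun h => le_trans hmem (monotone_cdf ν h), fun h => csInf_le hbdd h⟩

theorem monotoneOn_genInv_cdf : MonotoneOn (genInv (cdf ν)) (Ioo 0 1) := by
  intro s hs t ht hst
  rw [genInv_cdf_le_iff hs]
  exact hst.trans ((genInv_cdf_le_iff ht).1 le_rfl)

theorem aemeasurable_genInv_cdf :
    AEMeasurable (genInv (cdf ν)) (volume.restrict (Ioo (0 : ℝ) 1)) :=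
  aemeasurable_restrict_of_monotoneOn measurableSet_Ioo monotoneOn_genInv_cdf

variable [IsProbabilityMeasure ν]

instance : IsProbabilityMeasure (volume.restrict (Ioo (0 : ℝ) 1)) :=
  ⟨by simp⟩

/-- The quantile function pushes the uniform law on the unit interval to the given law. -/
theorem map_genInv_cdf : (volume.restrict (Ioo (0 : ℝ) 1)).map (genInv (cdf ν)) = ν := by
  have : IsProbabilityMeasure ((volume.restrict (Ioo (0 : ℝ) 1)).map (genInv (cdf ν))) :=
    Measure.isProbabilityMeasure_map aemeasurable_genInv_cdf
  refine Measure.ext_of_Iic _ _ fun x => ?_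
  rw [Measure.map_apply_of_aemeasurable aemeasurable_genInv_cdf measurableSet_Iic,
    ← ofReal_cdf ν x, Measure.restrict_apply₀' measurableSet_Ioo.nullMeasurableSet]
  have h1 : genInv (cdf ν) ⁻¹' Iic x ∩ Ioo 0 1 = Iic (cdf ν x) ∩ Ioo 0 1 := by
    ext t
    refine and_congr_left fun ht => ?_
    exact genInv_cdf_le_iff ht
  rw [h1]
  have h2 : (Iic (cdf ν x) ∩ Ioo 0 1 : Set ℝ) =ᵐ[volume] Ioc 0 (cdf ν x) := by
    have h3 : (Iic (cdf ν x) ∩ Ioo 0 1 : Set ℝ) =ᵐ[volume] (Iic (cdf ν x) ∩ Ioc 0 1 : Set ℝ) :=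
      (ae_eq_refl _).inter Ioo_ae_eq_Ioc
    have h4 : (Iic (cdf ν x) ∩ Ioc 0 1 : Set ℝ) = Ioc 0 (cdf ν x) := by
      ext t
      have := cdf_le_one ν x
      simp only [mem_inter_iff, mem_Iic, mem_Ioc]
      grind
    exact h3.trans (Filter.EventuallyEq.of_eq h4)
  rw [measure_congr h2]
  simp

theorem integrableOn_genInv_cdf (hν : Integrable (fun y : ℝ => y) ν) :
    IntegrableOn (genInv (cdf ν)) (Ioo 0 1) := by
  have h : Integrable (fun y : ℝ => y)
      ((volume.restrict (Ioo (0 : ℝ) 1)).map (genInv (cdf ν))) := by rwa [map_genInv_cdf]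
  exact (integrable_map_measure (by fun_prop) aemeasurable_genInv_cdf).1 h

theorem integral_comp_genInv_cdf {f : ℝ → ℝ} (hf : Measurable f) :
    ∫ t in Ioo (0 : ℝ) 1, f (genInv (cdf ν) t) = ∫ y, f y ∂ν := by
  conv_rhs => rw [← map_genInv_cdf (ν := ν)]
  rw [integral_map aemeasurable_genInv_cdf hf.aestronglyMeasurable]

theorem intervalIntegral_genInv_cdf {ν : Measure ℝ} {α : ℝ} (hα : α ≤ 1) :
    ∫ t in α..1, genInv (cdf ν) t = ∫ t in Ioo α 1, genInv (cdf ν) t := by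
  rw [intervalIntegral.integral_of_le hα, integral_Ioc_eq_integral_Ioo]

theorem integrable_call {Ω : Type*} [MeasurableSpace Ω] {P : Measure Ω} [IsFiniteMeasure P]
    {f : Ω → ℝ} (hf : Integrable f P) (k : ℝ) : Integrable (fun ω => max (f ω - k) 0) P :=
  (hf.sub (integrable_const k)).pos_part

/-- The Rockafellar-Uryasev bound: the integrated upper quantile is at most the affine expression
in the call function. -/
theorem integral_genInv_cdf_le (hν : Integrable (fun y : ℝ => y) ν) {α : ℝ}
    (hα : α ∈ Icc (0 : ℝ) 1) (k : ℝ) :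
    ∫ t in α..1, genInv (cdf ν) t ≤ k * (1 - α) + ∫ y, max (y - k) 0 ∂ν := by
  rw [intervalIntegral_genInv_cdf hα.2]
  have hsub : Ioo α 1 ⊆ Ioo 0 1 := Ioo_subset_Ioo_left hα.1
  have hq := integrableOn_genInv_cdf hν
  have hc : IntegrableOn (fun t => max (genInv (cdf ν) t - k) 0) (Ioo 0 1) := integrable_call hq k
  have h1 : ∫ t in Ioo α 1, genInv (cdf ν) t
      ≤ ∫ t in Ioo α 1, (k + max (genInv (cdf ν) t - k) 0) := by
    refine integral_mono (hq.mono_set hsub) ((integrable_const k).add (hc.mono_set hsub)) ?_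
    intro t
    have := le_max_left (genInv (cdf ν) t - k) 0
    simp only
    linarith
  have h2 : ∫ t in Ioo α 1, max (genInv (cdf ν) t - k) 0 ≤ ∫ y, max (y - k) 0 ∂ν := by
    rw [← integral_comp_genInv_cdf (ν := ν) (f := fun y => max (y - k) 0) (by fun_prop)]
    exact setIntegral_mono_set hc (ae_of_all _ fun t => le_max_right _ _) hsub.eventuallyLE
  rw [integral_add (integrable_const k) (hc.mono_set hsub)] at h1
  have h3 : ∫ _ in Ioo α 1, k = k * (1 - α) := by
    simp [max_eq_left (sub_nonneg.2 hα.2), mul_comm]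
  linarith

theorem integral_genInv_cdf_eq (hν : Integrable (fun y : ℝ => y) ν) {α : ℝ}
    (hα : α ∈ Ioo (0 : ℝ) 1) :
    ∫ t in α..1, genInv (cdf ν) t
      = genInv (cdf ν) α * (1 - α) + ∫ y, max (y - genInv (cdf ν) α) 0 ∂ν := by
  set k := genInv (cdf ν) α with hk
  rw [intervalIntegral_genInv_cdf hα.2.le]
  have hsub : Ioo α 1 ⊆ Ioo 0 1 := Ioo_subset_Ioo_left hα.1.le
  have hq := integrableOn_genInv_cdf hν
  rw [← integral_comp_genInv_cdf (ν := ν) (f := fun y => max (y - k) 0) (by fun_prop)]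
  have h1 : ∫ t in Ioo (0 : ℝ) 1, max (genInv (cdf ν) t - k) 0
      = ∫ t in Ioo (0 : ℝ) 1, (Ioo α 1).indicator (fun t => genInv (cdf ν) t - k) t := by
    refine setIntegral_congr_fun measurableSet_Ioo fun t ht => ?_
    by_cases hta : t ∈ Ioo α 1
    · rw [indicator_of_mem hta]
      exact max_eq_left (sub_nonneg.2 (monotoneOn_genInv_cdf hα ht hta.1.le))
    · rw [indicator_of_notMem hta]
      have hle : t ≤ α := by
        by_contra! h
        exact hta ⟨h, ht.2⟩
      exact max_eq_right (sub_nonpos.2 (monotoneOn_genInv_cdf ht hα hle))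
  rw [h1, setIntegral_indicator measurableSet_Ioo, inter_eq_self_of_subset_right hsub,
    integral_sub (hq.mono_set hsub) (integrable_const k)]
  have h3 : ∫ _ in Ioo α 1, k = k * (1 - α) := by
    simp [max_eq_left (sub_nonneg.2 hα.2.le), mul_comm]
  linarith

/-- The quantiles above `cdf ν s` are those exceeding `s`. -/
theorem lt_genInv_cdf_iff {ν : Measure ℝ} {t s : ℝ} (ht : t ∈ Ioo (0 : ℝ) 1) :
    s < genInv (cdf ν) t ↔ cdf ν s < t := by
  rw [← not_le, genInv_cdf_le_iff ht, not_le]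

theorem call_eq_integral_genInv_cdf (hν : Integrable (fun y : ℝ => y) ν) (k : ℝ) :
    ∫ t in (cdf ν k)..1, genInv (cdf ν) t
      = k * (1 - cdf ν k) + ∫ y, max (y - k) 0 ∂ν := by
  rw [intervalIntegral_genInv_cdf (cdf_le_one ν k)]
  have hsub : Ioo (cdf ν k) 1 ⊆ Ioo 0 1 := Ioo_subset_Ioo_left (cdf_nonneg ν k)
  have hq := integrableOn_genInv_cdf hν
  rw [← integral_comp_genInv_cdf (ν := ν) (f := fun y => max (y - k) 0) (by fun_prop)]
  have h1 : ∫ t in Ioo (0 : ℝ) 1, max (genInv (cdf ν) t - k) 0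
      = ∫ t in Ioo (0 : ℝ) 1, (Ioo (cdf ν k) 1).indicator (fun t => genInv (cdf ν) t - k) t := by
    refine setIntegral_congr_fun measurableSet_Ioo fun t ht => ?_
    by_cases hta : t ∈ Ioo (cdf ν k) 1
    · rw [indicator_of_mem hta]
      exact max_eq_left (sub_nonneg.2 ((lt_genInv_cdf_iff ht).2 hta.1).le)
    · rw [indicator_of_notMem hta]
      have hle : t ≤ cdf ν k := by
        by_contra! h
        exact hta ⟨h, ht.2⟩
      exact max_eq_right (sub_nonpos.2 ((genInv_cdf_le_iff ht).2 hle))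
  rw [h1, setIntegral_indicator measurableSet_Ioo, inter_eq_self_of_subset_right hsub,
    integral_sub (hq.mono_set hsub) (integrable_const k)]
  have h3 : ∫ _ in Ioo (cdf ν k) 1, k = k * (1 - cdf ν k) := by
    simp [max_eq_left (sub_nonneg.2 (cdf_le_one ν k)), mul_comm]
  linarith

theorem integral_zero_one_genInv_cdf :
    ∫ t in (0 : ℝ)..1, genInv (cdf ν) t = ∫ y, y ∂ν := by
  rw [intervalIntegral_genInv_cdf zero_le_one]
  exact integral_comp_genInv_cdf (f := fun y => y) (by fun_prop)

/-- For laws with the same mean, domination of call functions is the same as domination of the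
integrated upper quantiles. -/
theorem call_le_iff_integral_genInv_cdf_le {μ : Measure ℝ} [IsProbabilityMeasure μ]
    (hμ : Integrable (fun y : ℝ => y) μ) (hν : Integrable (fun y : ℝ => y) ν)
    (hmean : ∫ y, y ∂μ = ∫ y, y ∂ν) :
    (∀ k : ℝ, ∫ y, max (y - k) 0 ∂μ ≤ ∫ y, max (y - k) 0 ∂ν) ↔
      ∀ α ∈ Ioo (0 : ℝ) 1, ∫ t in α..1, genInv (cdf μ) t ≤ ∫ t in α..1, genInv (cdf ν) t := by
  constructor
  · intro h α hα
    rw [integral_genInv_cdf_eq hν hα]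
    exact (integral_genInv_cdf_le hμ ⟨hα.1.le, hα.2.le⟩ _).trans (add_le_add le_rfl (h _))
  · intro h k
    have h1 := call_eq_integral_genInv_cdf hμ k
    have hmem : cdf μ k ∈ Icc (0 : ℝ) 1 := ⟨cdf_nonneg μ k, cdf_le_one μ k⟩
    have h2 := integral_genInv_cdf_le hν hmem k
    have h3 : ∫ t in (cdf μ k)..1, genInv (cdf μ) t ≤ ∫ t in (cdf μ k)..1, genInv (cdf ν) t := by
      rcases hmem.1.eq_or_lt with h0 | h0
      · rw [← h0, integral_zero_one_genInv_cdf, integral_zero_one_genInv_cdf, hmean]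
      rcases hmem.2.eq_or_lt with h0' | h0'
      · rw [h0']; simp
      · exact h _ ⟨h0, h0'⟩
    linarith

/-- A centered law that is not a point mass has positive integrated upper quantiles. -/
theorem integral_genInv_cdf_pos (hν : Integrable (fun y : ℝ => y) ν) (hmean : ∫ y, y ∂ν = 0)
    (hne : ¬ ∀ᵐ y ∂ν, y = 0) {α : ℝ} (hα : α ∈ Ioo (0 : ℝ) 1) :
    0 < ∫ t in α..1, genInv (cdf ν) t := by
  have hcall : ∀ k : ℝ, 0 ≤ ∫ y, max (y - k) 0 ∂ν := fun k =>
    integral_nonneg fun y => le_max_right _ _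
  rw [integral_genInv_cdf_eq hν hα]
  set k := genInv (cdf ν) α
  rcases lt_trichotomy k 0 with hk | hk | hk
  · have h1 : ∫ y, (y - k) ∂ν ≤ ∫ y, max (y - k) 0 ∂ν :=
      integral_mono (hν.sub (integrable_const k)) (integrable_call hν k) fun y => le_max_left _ _
    rw [integral_sub hν (integrable_const k), hmean] at h1
    simp only [integral_const, probReal_univ, smul_eq_mul, one_mul, zero_sub] at h1
    nlinarith [hα.1]
  · rw [hk, zero_mul, zero_add]
    refine (hcall 0).lt_of_ne fun h0 => hne ?_
    have h1 := (integral_eq_zero_iff_of_nonneg (fun y : ℝ => le_max_right (y - 0) 0)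
      (integrable_call hν 0)).1 h0.symm
    have h2 : 0 ≤ᵐ[ν] fun y : ℝ => -y := by
      filter_upwards [h1] with y hy
      have := le_max_left (y - 0) 0
      simp only [Pi.zero_apply] at hy ⊢
      linarith
    have h3 : ∫ y, -y ∂ν = 0 := by rw [integral_neg, hmean, neg_zero]
    filter_upwards [(integral_eq_zero_iff_of_nonneg_ae h2 hν.neg).1 h3] with y hy
    simpa using hy
  · have := hcall k
    nlinarith [hα.2, mul_pos hk (sub_pos.2 hα.2)]

/-- Quantiles scale with positive factors. -/
theorem genInv_comp_div (F : ℝ → ℝ) {l : ℝ} (hl : 0 < l) (t : ℝ) :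
    genInv (fun x => F (x / l)) t = l * genInv F t := by
  have h : {x : ℝ | t ≤ F (x / l)} = l • {x : ℝ | t ≤ F x} := by
    ext x
    rw [Set.mem_smul_set_iff_inv_smul_mem₀ hl.ne']
    simp [div_eq_inv_mul]
  rw [genInv, h, Real.sInf_smul_of_nonneg hl.le, smul_eq_mul, genInv]

end Quantile

section Comonotone

open Set

variable {E : Type*} [MeasurableSpace E]

/-- For every measurable `h` there is a coupling of `μ` and `ν` whose second coordinate is
comonotone with `h` of the first one. -/
theorem exists_comonotone_coupling [StandardBorelSpace E] (μ : Measure E) [IsProbabilityMeasure μ]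
    (ν : Measure ℝ) [IsProbabilityMeasure ν] {h : E → ℝ} (hh : Measurable h) :
    ∃ π : Measure (E × ℝ), π.map Prod.fst = μ ∧ π.map Prod.snd = ν ∧
      ∀ s : ℝ, ∫ p in {p : E × ℝ | s < h p.1}, p.2 ∂π
        = ∫ t in (cdf (μ.map h) s)..1, genInv (cdf ν) t := by
  have hE : Nonempty E := nonempty_of_isProbabilityMeasure μ
  have hW : IsProbabilityMeasure (μ.map h) := Measure.isProbabilityMeasure_map hh.aemeasurable
  set κ : Kernel ℝ E := condDistrib id h μ
  set U : Measure ℝ := volume.restrict (Ioo (0 : ℝ) 1) with hU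
  have hqW : AEMeasurable (genInv (cdf (μ.map h))) U := aemeasurable_genInv_cdf
  have hqν : AEMeasurable (genInv (cdf ν)) U := aemeasurable_genInv_cdf
  have hq := hqW.prodMk hqν
  set ρ : Measure (ℝ × ℝ) := U.map fun t => (genInv (cdf (μ.map h)) t, genInv (cdf ν) t) with hρ
  have hρp : IsProbabilityMeasure ρ := Measure.isProbabilityMeasure_map hq
  have hρ1 : ρ.map Prod.fst = μ.map h := by
    rw [hρ, AEMeasurable.map_map_of_aemeasurable measurable_fst.aemeasurable hq]
    exact map_genInv_cdf
  have hρ2 : ρ.map Prod.snd = ν := by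
    rw [hρ, AEMeasurable.map_map_of_aemeasurable measurable_snd.aemeasurable hq]
    exact map_genInv_cdf
  set θ : Measure ((ℝ × ℝ) × E) := ρ ⊗ₘ (κ.comap Prod.fst measurable_fst) with hθ
  have hθ1 : θ.map Prod.fst = ρ := Measure.fst_compProd ρ _
  have hθ2 : θ.map (fun p => (p.1.1, p.2)) = μ.map fun x => (h x, x) := by
    have hcd : (μ.map h) ⊗ₘ κ = μ.map fun x => (h x, x) := compProd_map_condDistrib aemeasurable_id
    rw [← hcd]
    ext s hs
    rw [Measure.map_apply (by fun_prop) hs, hθ,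
      Measure.compProd_apply (hs.preimage (by fun_prop)), Measure.compProd_apply hs, ← hρ1,
      lintegral_map (Kernel.measurable_kernel_prodMk_left hs) measurable_fst]
    rfl
  have hθh : ∀ᵐ p ∂θ, h p.2 = p.1.1 := by
    have h1 : ∀ᵐ q ∂(θ.map fun p => (p.1.1, p.2)), h q.2 = q.1 := by
      rw [hθ2, ae_map_iff (by fun_prop) (measurableSet_eq_fun (by fun_prop) (by fun_prop))]
      exact ae_of_all _ fun _ => rfl
    exact ae_of_ae_map (by fun_prop) h1
  have hθx : θ.map Prod.snd = μ := by
    have h1 : (θ.map fun p => (p.1.1, p.2)).map Prod.snd = μ := by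
      rw [hθ2, Measure.map_map measurable_snd (by fun_prop)]
      exact Measure.map_id
    rwa [Measure.map_map measurable_snd (by fun_prop)] at h1
  have hg : Measurable fun p : (ℝ × ℝ) × E => (p.2, p.1.2) := by fun_prop
  refine ⟨θ.map fun p => (p.2, p.1.2), ?_, ?_, fun s => ?_⟩
  · rw [Measure.map_map measurable_fst hg]
    exact hθx
  · rw [Measure.map_map measurable_snd hg, ← hρ2, ← hθ1, Measure.map_map (by fun_prop) (by fun_prop)]
    rfl
  · have hms : MeasurableSet {p : E × ℝ | s < h p.1} :=
      measurableSet_lt measurable_const (by fun_prop)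
    have hms' : MeasurableSet {a : ℝ × ℝ | s < a.1} :=
      measurableSet_lt measurable_const (by fun_prop)
    rw [← integral_indicator hms, integral_map hg.aemeasurable
      ((measurable_snd.indicator hms).aestronglyMeasurable)]
    have h1 : ∫ p, {p : E × ℝ | s < h p.1}.indicator (fun p => p.2) (p.2, p.1.2) ∂θ
        = ∫ p, {a : ℝ × ℝ | s < a.1}.indicator (fun a => a.2) p.1 ∂θ := by
      refine integral_congr_ae ?_
      filter_upwards [hθh] with p hp
      simp only [indicator_apply, mem_ofPred_eq, hp]
    rw [h1, ← integral_map (φ := Prod.fst) (by fun_prop)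
      ((measurable_snd.indicator hms').aestronglyMeasurable), hθ1, hρ,
      integral_map hq ((measurable_snd.indicator hms').aestronglyMeasurable),
      intervalIntegral_genInv_cdf (cdf_le_one _ s)]
    have hsub : Ioo (cdf (μ.map h) s) 1 ⊆ Ioo 0 1 := Ioo_subset_Ioo_left (cdf_nonneg _ s)
    have h2 : ∫ t in Ioo (0 : ℝ) 1, {a : ℝ × ℝ | s < a.1}.indicator (fun a => a.2)
          (genInv (cdf (μ.map h)) t, genInv (cdf ν) t)
        = ∫ t in Ioo (0 : ℝ) 1, (Ioo (cdf (μ.map h) s) 1).indicator (genInv (cdf ν)) t := by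
      refine setIntegral_congr_fun measurableSet_Ioo fun t ht => ?_
      have := lt_genInv_cdf_iff (ν := μ.map h) (s := s) ht
      simp only [indicator_apply, mem_ofPred_eq, mem_Ioo, this, ht.2, and_true]
    rw [hU, h2, setIntegral_indicator measurableSet_Ioo, inter_eq_self_of_subset_right hsub]

/-- If the call functions of `z` under `μ` are dominated by those of `ν`, then integrals of `z` over
events are bounded by integrated upper quantiles of `ν`. -/
theorem setIntegral_le_integral_genInv_cdf {μ : Measure E} [IsProbabilityMeasure μ]
    {ν : Measure ℝ} [IsProbabilityMeasure ν] (hν : Integrable (fun y : ℝ => y) ν)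
    {z : E → ℝ} (hz : Integrable z μ) (hmean : ∫ x, z x ∂μ = ∫ y, y ∂ν)
    (hcall : ∀ k : ℝ, ∫ x, max (z x - k) 0 ∂μ ≤ ∫ y, max (y - k) 0 ∂ν)
    {A : Set E} (hA : MeasurableSet A) :
    ∫ x in A, z x ∂μ ≤ ∫ t in (1 - μ.real A)..1, genInv (cdf ν) t := by
  have hbound : ∀ k : ℝ, ∫ x in A, z x ∂μ ≤ k * μ.real A + ∫ y, max (y - k) 0 ∂ν := by
    intro k
    have h1 : ∫ x in A, z x ∂μ ≤ ∫ x in A, (k + max (z x - k) 0) ∂μ := by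
      refine integral_mono hz.restrict
        ((integrable_const k).add (integrable_call hz k).restrict) fun x => ?_
      have := le_max_left (z x - k) 0
      simp only
      linarith
    rw [integral_add (integrable_const k) (integrable_call hz k).restrict, setIntegral_const,
      smul_eq_mul] at h1
    have h2 : ∫ x in A, max (z x - k) 0 ∂μ ≤ ∫ x, max (z x - k) 0 ∂μ :=
      setIntegral_le_integral (integrable_call hz k) (ae_of_all _ fun x => le_max_right _ _)
    linarith [hcall k]
  rcases (measureReal_nonneg (μ := μ) (s := A)).eq_or_lt with h0 | h0
  · have hA0 : μ A = 0 := (measureReal_eq_zero_iff).1 h0.symm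
    rw [← h0, setIntegral_measure_zero _ hA0]
    simp
  rcases (measureReal_le_one (μ := μ) (s := A)).eq_or_lt with h1 | h1
  · have hAc : ∀ᵐ x ∂μ, x ∈ A := by
      refine (mem_ae_iff_prob_eq_one hA).2 ?_
      simpa [measureReal_def, ENNReal.toReal_eq_one_iff] using h1
    rw [h1, sub_self, integral_zero_one_genInv_cdf, ← hmean,
      Measure.restrict_eq_self_of_ae_mem hAc]
  · have hα : 1 - μ.real A ∈ Ioo (0 : ℝ) 1 := ⟨by linarith, by linarith⟩
    rw [integral_genInv_cdf_eq hν hα, sub_sub_cancel]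
    exact hbound _

end Comonotone

section LayerCake

open Set

variable {Ω : Type*} [MeasurableSpace Ω]

/-- The layer cake formula for a bounded weight. -/
theorem integral_mul_eq_integral_setIntegral {P : Measure Ω} [IsProbabilityMeasure P]
    {f g : Ω → ℝ} (hf : Integrable f P) (hg : Measurable g) {M : ℝ} (hM : ∀ ω, |g ω| ≤ M) :
    ∫ ω, f ω * g ω ∂P
      = (∫ s in Ioc (-M) M, ∫ ω in {ω | s < g ω}, f ω ∂P) - M * ∫ ω, f ω ∂P := by
  have hM0 : 0 ≤ M := by
    obtain ⟨ω⟩ := nonempty_of_isProbabilityMeasure P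
    exact (abs_nonneg _).trans (hM ω)
  have hms : ∀ s, MeasurableSet {ω | s < g ω} := fun s => measurableSet_lt measurable_const hg
  have hS : MeasurableSet {q : ℝ × Ω | q.1 < g q.2} :=
    measurableSet_lt measurable_fst (hg.comp measurable_snd)
  have hint : Integrable (Function.uncurry fun (s : ℝ) (ω : Ω) => {ω | s < g ω}.indicator f ω)
      ((volume.restrict (Ioc (-M) M)).prod P) := by
    have h1 : Integrable (fun q : ℝ × Ω => f q.2) ((volume.restrict (Ioc (-M) M)).prod P) :=
      hf.comp_snd _
    exact h1.indicator hS
  have h1 : ∫ s in Ioc (-M) M, ∫ ω in {ω | s < g ω}, f ω ∂P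
      = ∫ ω, (∫ s in Ioc (-M) M, {ω | s < g ω}.indicator f ω) ∂P := by
    rw [← integral_integral_swap hint]
    exact integral_congr_ae (ae_of_all _ fun s => (integral_indicator (hms s)).symm)
  have h2 : ∀ ω, ∫ s in Ioc (-M) M, {ω | s < g ω}.indicator f ω = f ω * g ω + M * f ω := by
    intro ω
    have hle := abs_le.1 (hM ω)
    have h3 : (fun s => {ω | s < g ω}.indicator f ω) = (Iio (g ω)).indicator fun _ => f ω := by
      ext s
      simp [indicator_apply]
    have h4 : (Ioc (-M) M ∩ Iio (g ω) : Set ℝ) =ᵐ[volume] Ioc (-M) (g ω) := by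
      have h5 : (Ioc (-M) M ∩ Iio (g ω) : Set ℝ) =ᵐ[volume] (Ioc (-M) M ∩ Iic (g ω) : Set ℝ) :=
        (ae_eq_refl _).inter Iio_ae_eq_Iic
      have h6 : Ioc (-M) M ∩ Iic (g ω) = Ioc (-M) (g ω) := by
        rw [Ioc_inter_Iic, inf_of_le_right hle.2]
      exact h5.trans (Filter.EventuallyEq.of_eq h6)
    rw [h3, setIntegral_indicator measurableSet_Iio, setIntegral_congr_set h4, setIntegral_const]
    simp only [measureReal_def, Real.volume_Ioc, smul_eq_mul]
    rw [ENNReal.toReal_ofReal (by linarith)]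
    ring
  have hfg : Integrable (fun ω => f ω * g ω) P :=
    hf.mul_bdd hg.aestronglyMeasurable (ae_of_all _ fun ω => (hM ω : ‖g ω‖ ≤ M))
  rw [h1, integral_congr_ae (ae_of_all _ h2), integral_add hfg (hf.const_mul M),
    integral_const_mul, add_sub_cancel_right]

theorem integrableOn_setIntegral_superlevel {P : Measure Ω} [IsProbabilityMeasure P]
    {f g : Ω → ℝ} (hf : Integrable f P) (hg : Measurable g) (M : ℝ) :
    IntegrableOn (fun s => ∫ ω in {ω | s < g ω}, f ω ∂P) (Ioc (-M) M) := by
  have hS : MeasurableSet {q : ℝ × Ω | q.1 < g q.2} :=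
    measurableSet_lt measurable_fst (hg.comp measurable_snd)
  have h1 : Integrable (fun q : ℝ × Ω => f q.2) ((volume.restrict (Ioc (-M) M)).prod P) :=
    hf.comp_snd _
  refine (h1.indicator hS).integral_prod_left.congr (ae_of_all _ fun s => ?_)
  exact integral_indicator (measurableSet_lt measurable_const hg)

/-- For every bounded weight `h` of the first coordinate, some coupling has a cross moment with `h` at
least that of `z`. -/
theorem exists_coupling_integral_mul_le {E : Type*} [MeasurableSpace E] [StandardBorelSpace E]
    {μ : Measure E} [IsProbabilityMeasure μ]
    {ν : Measure ℝ} [IsProbabilityMeasure ν] (hν : Integrable (fun y : ℝ => y) ν)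
    {z : E → ℝ} (hz : Integrable z μ) (hmean : ∫ x, z x ∂μ = ∫ y, y ∂ν)
    (hcall : ∀ k : ℝ, ∫ x, max (z x - k) 0 ∂μ ≤ ∫ y, max (y - k) 0 ∂ν)
    {h : E → ℝ} (hh : Measurable h) {M : ℝ} (hM : ∀ x, |h x| ≤ M) :
    ∃ π : Measure (E × ℝ), π.map Prod.fst = μ ∧ π.map Prod.snd = ν ∧
      ∫ x, z x * h x ∂μ ≤ ∫ p, p.2 * h p.1 ∂π := by
  obtain ⟨π, h1, h2, h3⟩ := exists_comonotone_coupling μ ν hh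
  have hπ : IsProbabilityMeasure π := by
    have : IsProbabilityMeasure (π.map Prod.fst) := by rw [h1]; infer_instance
    exact Measure.isProbabilityMeasure_of_map Prod.fst
  have hW : IsProbabilityMeasure (μ.map h) := Measure.isProbabilityMeasure_map hh.aemeasurable
  have hsnd : Integrable (fun p : E × ℝ => p.2) π := by
    rw [← h2] at hν
    exact (integrable_map_measure (f := Prod.snd) (by fun_prop) (by fun_prop)).1 hν
  have hmean2 : ∫ p, p.2 ∂π = ∫ y, y ∂ν := by
    rw [← h2, integral_map (by fun_prop) (by fun_prop)]
  refine ⟨π, h1, h2, ?_⟩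
  rw [integral_mul_eq_integral_setIntegral hz hh hM,
    integral_mul_eq_integral_setIntegral (g := fun p : E × ℝ => h p.1) hsnd (by fun_prop)
      (fun p => hM p.1), hmean, hmean2]
  refine sub_le_sub_right (integral_mono (integrableOn_setIntegral_superlevel hz hh M)
    (integrableOn_setIntegral_superlevel (g := fun p : E × ℝ => h p.1) hsnd (by fun_prop) M)
    fun s => ?_) _
  have hms : MeasurableSet {x | s < h x} := measurableSet_lt measurable_const hh
  have hcdf : cdf (μ.map h) s = 1 - μ.real {x | s < h x} := by
    rw [cdf_eq_real, map_measureReal_apply hh measurableSet_Iic, ← probReal_compl_eq_one_sub hms]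
    congr 1
    ext x
    simp
  simp only [h3 s, hcdf]
  exact setIntegral_le_integral_genInv_cdf hν hz hmean hcall hms

end LayerCake

section Strassen

open Set Filter Topology
open scoped BoundedContinuousFunction ENNReal

variable {E : Type*} [MeasurableSpace E]

/-- The couplings of two probability measures. -/
def couplings (μ : Measure E) (ν : Measure ℝ) : Set (ProbabilityMeasure (E × ℝ)) :=
  {π | (π : Measure (E × ℝ)).map Prod.fst = μ ∧ (π : Measure (E × ℝ)).map Prod.snd = ν}

theorem integrable_snd_of_mem_couplings {μ : Measure E} {ν : Measure ℝ}
    (hν : Integrable (fun y : ℝ => y) ν) {π : ProbabilityMeasure (E × ℝ)}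
    (hπ : π ∈ couplings μ ν) : Integrable (fun p : E × ℝ => p.2) (π : Measure (E × ℝ)) := by
  rw [← hπ.2] at hν
  exact (integrable_map_measure (f := Prod.snd) (by fun_prop) (by fun_prop)).1 hν

/-- Convex combinations of couplings are couplings. -/
theorem exists_mem_couplings_integral_eq {μ : Measure E} {ν : Measure ℝ}
    {π₁ π₂ : ProbabilityMeasure (E × ℝ)} (h₁ : π₁ ∈ couplings μ ν) (h₂ : π₂ ∈ couplings μ ν)
    {a b : ℝ} (ha : 0 ≤ a) (hb : 0 ≤ b) (hab : a + b = 1) :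
    ∃ π ∈ couplings μ ν, ∀ f : E × ℝ → ℝ, Integrable f (π₁ : Measure (E × ℝ)) →
      Integrable f (π₂ : Measure (E × ℝ)) →
      ∫ p, f p ∂(π : Measure (E × ℝ))
        = a * ∫ p, f p ∂(π₁ : Measure (E × ℝ)) + b * ∫ p, f p ∂(π₂ : Measure (E × ℝ)) := by
  have hab' : ENNReal.ofReal a + ENNReal.ofReal b = 1 := by
    rw [← ENNReal.ofReal_add ha hb, hab, ENNReal.ofReal_one]
  set m : Measure (E × ℝ) :=
    ENNReal.ofReal a • (π₁ : Measure (E × ℝ)) + ENNReal.ofReal b • (π₂ : Measure (E × ℝ)) with hm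
  have hmp : IsProbabilityMeasure m := ⟨by simp [hm, hab']⟩
  refine ⟨⟨m, hmp⟩, ⟨?_, ?_⟩, fun f hf₁ hf₂ => ?_⟩
  · change m.map Prod.fst = μ
    rw [hm, Measure.map_add _ _ measurable_fst, Measure.map_smul, Measure.map_smul, h₁.1, h₂.1,
      ← add_smul, hab', one_smul]
  · change m.map Prod.snd = ν
    rw [hm, Measure.map_add _ _ measurable_snd, Measure.map_smul, Measure.map_smul, h₁.2, h₂.2,
      ← add_smul, hab', one_smul]
  · change ∫ p, f p ∂m = _
    rw [hm, integral_add_measure (hf₁.smul_measure ENNReal.ofReal_ne_top)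
      (hf₂.smul_measure ENNReal.ofReal_ne_top), integral_smul_measure, integral_smul_measure,
      ENNReal.toReal_ofReal ha, ENNReal.toReal_ofReal hb, smul_eq_mul, smul_eq_mul]

variable [TopologicalSpace E] [BorelSpace E]

theorem integrable_snd_mul_of_mem_couplings {μ : Measure E} {ν : Measure ℝ}
    (hν : Integrable (fun y : ℝ => y) ν) {π : ProbabilityMeasure (E × ℝ)}
    (hπ : π ∈ couplings μ ν) (φ : E →ᵇ ℝ) :
    Integrable (fun p : E × ℝ => p.2 * φ p.1) (π : Measure (E × ℝ)) :=
  (integrable_snd_of_mem_couplings hν hπ).mul_bdd (c := ‖φ‖)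
    (φ.continuous.comp continuous_fst).aestronglyMeasurable
    (ae_of_all _ fun p => φ.norm_coe_le_norm p.1)

/-- Truncation of a real number to `[-n, n]`. -/
def truncReal (n : ℕ) (y : ℝ) : ℝ := max (-n) (min y n)

theorem continuous_truncReal (n : ℕ) : Continuous (truncReal n) := by
  unfold truncReal; fun_prop

theorem abs_truncReal_le (n : ℕ) (y : ℝ) : |truncReal n y| ≤ n := by
  have : (0 : ℝ) ≤ n := n.cast_nonneg
  rw [abs_le]
  exact ⟨le_max_left _ _, max_le (by linarith) (min_le_right _ _)⟩

theorem abs_sub_truncReal_le (n : ℕ) (y : ℝ) : |y - truncReal n y| ≤ |y| := by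
  have : (0 : ℝ) ≤ n := n.cast_nonneg
  unfold truncReal
  rcases le_total y n with h | h
  · rw [min_eq_left h]
    rcases le_total (-(n : ℝ)) y with h' | h'
    · rw [max_eq_right h']; simp
    · rw [max_eq_left h', abs_of_nonpos (by linarith), abs_of_nonpos (by linarith)]; linarith
  · rw [min_eq_right h, max_eq_right (by linarith), abs_of_nonneg (by linarith),
      abs_of_nonneg (by linarith)]
    linarith

theorem truncReal_of_abs_le {n : ℕ} {y : ℝ} (h : |y| ≤ n) : truncReal n y = y := by
  have := abs_le.1 h
  rw [truncReal, min_eq_left this.2, max_eq_right this.1]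

theorem tendsto_integral_abs_sub_truncReal {ν : Measure ℝ} (hν : Integrable (fun y : ℝ => y) ν) :
    Tendsto (fun n : ℕ => ∫ y, |y - truncReal n y| ∂ν) atTop (𝓝 0) := by
  have h : Tendsto (fun n : ℕ => ∫ y, |y - truncReal n y| ∂ν) atTop (𝓝 (∫ _, (0 : ℝ) ∂ν)) := by
    refine tendsto_integral_of_dominated_convergence (fun y => |y|) (fun n => ?_) hν.abs
      (fun n => ae_of_all _ fun y => ?_) (ae_of_all _ fun y => ?_)
    · have := continuous_truncReal n
      exact (by fun_prop : Continuous fun y => |y - truncReal n y|).aestronglyMeasurable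
    · rw [Real.norm_eq_abs, abs_abs]
      exact abs_sub_truncReal_le n y
    · obtain ⟨N, hN⟩ := exists_nat_ge |y|
      refine tendsto_const_nhds.congr' ?_
      filter_upwards [eventually_ge_atTop N] with n hn
      rw [truncReal_of_abs_le (hN.trans (Nat.cast_le.2 hn)), sub_self, abs_zero]
  simpa using h

/-- On couplings with an integrable second marginal, cross moments are continuous. -/
theorem continuousOn_integral_snd_mul {μ : Measure E} {ν : Measure ℝ}
    (hν : Integrable (fun y : ℝ => y) ν) (φ : E →ᵇ ℝ) :
    ContinuousOn (fun π : ProbabilityMeasure (E × ℝ) =>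
      ∫ p, p.2 * φ p.1 ∂(π : Measure (E × ℝ))) (couplings μ ν) := by
  have hlim : TendstoUniformlyOn (fun (n : ℕ) (π : ProbabilityMeasure (E × ℝ)) =>
      ∫ p, truncReal n p.2 * φ p.1 ∂(π : Measure (E × ℝ)))
      (fun π => ∫ p, p.2 * φ p.1 ∂(π : Measure (E × ℝ))) atTop (couplings μ ν) := by
    rw [Metric.tendstoUniformlyOn_iff]
    intro ε hε
    have h0 := (tendsto_integral_abs_sub_truncReal hν).mul_const ‖φ‖
    rw [zero_mul] at h0
    filter_upwards [h0.eventually (gt_mem_nhds hε)] with n hn π hπ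
    refine lt_of_le_of_lt ?_ hn
    have hi := integrable_snd_of_mem_couplings hν hπ
    have hcont := continuous_truncReal n
    have ht : Integrable (fun p : E × ℝ => truncReal n p.2 * φ p.1) (π : Measure (E × ℝ)) := by
      refine Integrable.of_bound
        (by fun_prop : Continuous fun p : E × ℝ => truncReal n p.2 * φ p.1).aestronglyMeasurable
        (n * ‖φ‖) (ae_of_all _ fun p => ?_)
      rw [norm_mul]
      gcongr
      · exact abs_truncReal_le n p.2
      · exact φ.norm_coe_le_norm p.1
    rw [dist_eq_norm, ← integral_sub (integrable_snd_mul_of_mem_couplings hν hπ φ) ht]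
    have hmeas : AEStronglyMeasurable (fun y : ℝ => |y - truncReal n y|) ν :=
      (by fun_prop : Continuous fun y => |y - truncReal n y|).aestronglyMeasurable
    have habs : Integrable (fun y : ℝ => |y - truncReal n y|) ν :=
      hν.abs.mono hmeas (ae_of_all _ fun y => by simpa using abs_sub_truncReal_le n y)
    have habs' : Integrable (fun p : E × ℝ => |p.2 - truncReal n p.2|) (π : Measure (E × ℝ)) := by
      rw [← hπ.2] at habs
      exact (integrable_map_measure (f := Prod.snd)
        (by rw [hπ.2]; exact hmeas) (by fun_prop)).1 habs
    calc ‖∫ p, (p.2 * φ p.1 - truncReal n p.2 * φ p.1) ∂(π : Measure (E × ℝ))‖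
        ≤ ∫ p, |p.2 - truncReal n p.2| * ‖φ‖ ∂(π : Measure (E × ℝ)) := by
          refine norm_integral_le_of_norm_le (habs'.mul_const _) (ae_of_all _ fun p => ?_)
          rw [← sub_mul, norm_mul, Real.norm_eq_abs]
          gcongr
          exact φ.norm_coe_le_norm p.1
      _ = (∫ y, |y - truncReal n y| ∂ν) * ‖φ‖ := by
          rw [integral_mul_const, ← hπ.2, integral_map (by fun_prop) (by rw [hπ.2]; exact hmeas)]
  refine hlim.continuousOn (Frequently.of_forall fun n => Continuous.continuousOn ?_)
  let g : (E × ℝ) →ᵇ ℝ := BoundedContinuousFunction.ofNormedAddCommGroup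
    (fun p : E × ℝ => truncReal n p.2 * φ p.1)
    (by have := continuous_truncReal n; fun_prop) (n * ‖φ‖) (fun p => by
      rw [norm_mul]
      gcongr
      · exact abs_truncReal_le n p.2
      · exact φ.norm_coe_le_norm p.1)
  exact continuous_iff_continuousAt.2 fun π =>
    (ProbabilityMeasure.tendsto_iff_forall_integral_tendsto.1 tendsto_id) g

variable [PolishSpace E]

theorem isClosed_couplings (μ : Measure E) [IsProbabilityMeasure μ] (ν : Measure ℝ)
    [IsProbabilityMeasure ν] : IsClosed (couplings μ ν) := by
  let μ' : ProbabilityMeasure E := ⟨μ, inferInstance⟩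
  let ν' : ProbabilityMeasure ℝ := ⟨ν, inferInstance⟩
  have h : couplings μ ν
      = {π | π.map (f := Prod.fst) (by fun_prop) = μ'}
        ∩ {π | π.map (f := Prod.snd) (by fun_prop) = ν'} := by
    ext π
    refine and_congr ⟨fun h => Subtype.ext h, fun h => congrArg Subtype.val h⟩
      ⟨fun h => Subtype.ext h, fun h => congrArg Subtype.val h⟩
  rw [h]
  exact (isClosed_eq (ProbabilityMeasure.continuous_map continuous_fst) continuous_const).inter
    (isClosed_eq (ProbabilityMeasure.continuous_map continuous_snd) continuous_const)

theorem isCompact_couplings (μ : Measure E) [IsProbabilityMeasure μ] (ν : Measure ℝ)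
    [IsProbabilityMeasure ν] : IsCompact (couplings μ ν) := by
  rw [← (isClosed_couplings μ ν).closure_eq]
  refine isCompact_closure_of_isTightMeasureSet ?_
  rw [isTightMeasureSet_iff_exists_isCompact_measure_compl_le]
  intro ε hε
  have hε2 : 0 < ε / 2 := ENNReal.half_pos hε.ne'
  obtain ⟨K, hK, hK'⟩ := isTightMeasureSet_iff_exists_isCompact_measure_compl_le.1
    (isTightMeasureSet_singleton (μ := μ)) _ hε2
  obtain ⟨L, hL, hL'⟩ := isTightMeasureSet_iff_exists_isCompact_measure_compl_le.1
    (isTightMeasureSet_singleton (μ := ν)) _ hε2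
  refine ⟨K ×ˢ L, hK.prod hL, ?_⟩
  rintro _ ⟨π, ⟨h1, h2⟩, rfl⟩
  have hsub : (K ×ˢ L)ᶜ ⊆ (Prod.fst ⁻¹' Kᶜ : Set (E × ℝ)) ∪ Prod.snd ⁻¹' Lᶜ := by
    rintro p hp
    by_contra! h
    simp only [mem_union, mem_preimage, mem_compl_iff, not_or, not_not] at h
    exact hp h
  calc (π : Measure (E × ℝ)) (K ×ˢ L)ᶜ
      ≤ (π : Measure (E × ℝ)) (Prod.fst ⁻¹' Kᶜ) + (π : Measure (E × ℝ)) (Prod.snd ⁻¹' Lᶜ) :=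
        (measure_mono hsub).trans (measure_union_le _ _)
    _ = μ Kᶜ + ν Lᶜ := by
        rw [← Measure.map_apply measurable_fst hK.isClosed.measurableSet.compl, h1,
          ← Measure.map_apply measurable_snd hL.isClosed.measurableSet.compl, h2]
    _ ≤ ε / 2 + ε / 2 := add_le_add (hK' μ rfl) (hL' ν rfl)
    _ = ε := ENNReal.add_halves ε

/-- Strassen's theorem, in weak form: domination of call functions yields a coupling whose
conditional mean is prescribed, tested against bounded continuous functions. -/
theorem exists_coupling_integral_eq {μ : Measure E} [IsProbabilityMeasure μ]
    {ν : Measure ℝ} [IsProbabilityMeasure ν] (hν : Integrable (fun y : ℝ => y) ν)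
    {z : E → ℝ} (hz : Integrable z μ) (hmean : ∫ x, z x ∂μ = ∫ y, y ∂ν)
    (hcall : ∀ k : ℝ, ∫ x, max (z x - k) 0 ∂μ ≤ ∫ y, max (y - k) 0 ∂ν) :
    ∃ π ∈ couplings μ ν, ∀ φ : E →ᵇ ℝ,
      ∫ p, p.2 * φ p.1 ∂(π : Measure (E × ℝ)) = ∫ x, z x * φ x ∂μ := by
  have hzφ : ∀ φ : E →ᵇ ℝ, Integrable (fun x => z x * φ x) μ := fun φ =>
    hz.mul_bdd (c := ‖φ‖) φ.continuous.aestronglyMeasurable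
      (ae_of_all _ fun x => φ.norm_coe_le_norm x)
  let t : (E →ᵇ ℝ) → Set (ProbabilityMeasure (E × ℝ)) := fun φ =>
    couplings μ ν ∩ (fun π : ProbabilityMeasure (E × ℝ) =>
      ∫ p, p.2 * φ p.1 ∂(π : Measure (E × ℝ))) ⁻¹' {∫ x, z x * φ x ∂μ}
  have ht : ∀ φ, IsClosed (t φ) := fun φ =>
    (continuousOn_integral_snd_mul hν φ).preimage_isClosed_of_isClosed
      (isClosed_couplings μ ν) isClosed_singleton
  suffices h : (couplings μ ν ∩ ⋂ φ, t φ).Nonempty by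
    obtain ⟨π, hπ, hπ'⟩ := h
    exact ⟨π, hπ, fun φ => (mem_iInter.1 hπ' φ).2⟩
  refine (isCompact_couplings μ ν).inter_iInter_nonempty t ht fun u => ?_
  let T : ProbabilityMeasure (E × ℝ) → (u → ℝ) := fun π φ =>
    ∫ p, p.2 * φ.1 p.1 ∂(π : Measure (E × ℝ)) - ∫ x, z x * φ.1 x ∂μ
  have hTc : ContinuousOn T (couplings μ ν) :=
    continuousOn_pi.2 fun φ => (continuousOn_integral_snd_mul hν φ.1).sub continuousOn_const
  have hclosed : IsClosed (T '' couplings μ ν) :=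
    ((isCompact_couplings μ ν).image_of_continuousOn hTc).isClosed
  have hconv : Convex ℝ (T '' couplings μ ν) := by
    rintro _ ⟨π₁, h₁, rfl⟩ _ ⟨π₂, h₂, rfl⟩ a b ha hb hab
    obtain ⟨π, hπ, hπ'⟩ := exists_mem_couplings_integral_eq h₁ h₂ ha hb hab
    refine ⟨π, hπ, ?_⟩
    ext φ
    simp only [T, Pi.add_apply, Pi.smul_apply, smul_eq_mul]
    rw [hπ' _ (integrable_snd_mul_of_mem_couplings hν h₁ φ.1)
      (integrable_snd_mul_of_mem_couplings hν h₂ φ.1)]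
    linear_combination (∫ x, z x * φ.1 x ∂μ) * hab
  have hzero : (0 : u → ℝ) ∈ T '' couplings μ ν := by
    classical
    by_contra hnot
    obtain ⟨f, r, hr0, hr⟩ := geometric_hahn_banach_point_closed hconv hclosed hnot
    rw [map_zero] at hr0
    let c : u → ℝ := fun φ => f (Pi.single φ 1)
    let g : E →ᵇ ℝ := ∑ φ : u, c φ • φ.1
    have hg : ∀ x, g x = ∑ φ : u, c φ * φ.1 x := fun x => by
      simp [g, BoundedContinuousFunction.sum_apply]
    have hpos : ∀ π ∈ couplings μ ν,
        ∫ x, z x * g x ∂μ < ∫ p, p.2 * g p.1 ∂(π : Measure (E × ℝ)) := by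
      intro π hπ
      have h1 : f (T π) = ∑ φ : u, T π φ * c φ := by
        have := LinearMap.pi_apply_eq_sum_univ (f : (u → ℝ) →ₗ[ℝ] ℝ) (T π)
        simp only [ContinuousLinearMap.coe_coe, smul_eq_mul] at this
        rw [this]
        refine Finset.sum_congr rfl fun φ _ => ?_
        simp only [c]
        congr 2
        ext i
        simp [Pi.single_apply, eq_comm]
      have h2 : ∫ p, p.2 * g p.1 ∂(π : Measure (E × ℝ))
          = ∑ φ : u, c φ * ∫ p, p.2 * φ.1 p.1 ∂(π : Measure (E × ℝ)) := by
        simp only [hg, Finset.mul_sum, ← integral_const_mul]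
        rw [← integral_finsetSum _ fun φ _ =>
          (integrable_snd_mul_of_mem_couplings hν hπ φ.1).const_mul (c φ)]
        refine integral_congr_ae (ae_of_all _ fun p => Finset.sum_congr rfl fun φ _ => ?_)
        ring
      have h3 : ∫ x, z x * g x ∂μ = ∑ φ : u, c φ * ∫ x, z x * φ.1 x ∂μ := by
        simp only [hg, Finset.mul_sum, ← integral_const_mul]
        rw [← integral_finsetSum _ fun φ _ => (hzφ φ.1).const_mul (c φ)]
        refine integral_congr_ae (ae_of_all _ fun p => Finset.sum_congr rfl fun φ _ => ?_)
        ring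
      have h4 : f (T π) = ∫ p, p.2 * g p.1 ∂(π : Measure (E × ℝ)) - ∫ x, z x * g x ∂μ := by
        rw [h1, h2, h3, ← Finset.sum_sub_distrib]
        refine Finset.sum_congr rfl fun φ _ => ?_
        simp only [T]
        ring
      have := hr _ (mem_image_of_mem T hπ)
      linarith
    obtain ⟨π, hπ1, hπ2, hπ3⟩ := exists_coupling_integral_mul_le hν hz hmean hcall
      (h := fun x => (-g) x) (-g).continuous.measurable (M := ‖-g‖)
      fun x => (-g).norm_coe_le_norm x
    have hπp : IsProbabilityMeasure π := by
      have : IsProbabilityMeasure (π.map Prod.fst) := by rw [hπ1]; infer_instance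
      exact Measure.isProbabilityMeasure_of_map Prod.fst
    have := hpos ⟨π, hπp⟩ ⟨hπ1, hπ2⟩
    simp only [BoundedContinuousFunction.coe_neg, Pi.neg_apply, mul_neg, integral_neg] at hπ3
    change _ < ∫ p, p.2 * g p.1 ∂π at this
    linarith
  obtain ⟨π, hπ, hπ0⟩ := hzero
  refine ⟨π, hπ, mem_iInter₂.2 fun φ hφ => ⟨hπ, ?_⟩⟩
  have := congrFun hπ0 ⟨φ, hφ⟩
  exact sub_eq_zero.1 this

/-- Equality of cross moments with bounded continuous functions identifies the conditional
expectation given the first coordinate. -/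
theorem condExp_fst_eq_of_integral_mul_eq {π : Measure (E × ℝ)} [IsProbabilityMeasure π]
    (hi : Integrable (fun p : E × ℝ => p.2) π) {z : E → ℝ} (hzm : Measurable z)
    (hz : Integrable (fun p : E × ℝ => z p.1) π)
    (h : ∀ φ : E →ᵇ ℝ, ∫ p, p.2 * φ p.1 ∂π = ∫ p, z p.1 * φ p.1 ∂π) :
    π[fun p => p.2 | MeasurableSpace.comap Prod.fst inferInstance] =ᵐ[π] fun p => z p.1 := by
  set d : E × ℝ → ℝ := fun p => p.2 - z p.1 with hd
  have hdm : Measurable d := by fun_prop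
  have hdi : Integrable d π := hi.sub hz
  have hfin : ∀ f : E × ℝ → ℝ, Integrable f π →
      IsFiniteMeasure (π.withDensity fun p => ENNReal.ofReal (f p)) := fun f hf =>
    isFiniteMeasure_withDensity_ofReal hf.2
  have hint : ∀ f : E × ℝ → ℝ, Measurable f → ∀ g : E × ℝ → ℝ,
      ∫ p, g p ∂(π.withDensity fun p => ENNReal.ofReal (f p)) = ∫ p, max (f p) 0 * g p ∂π := by
    intro f hf g
    rw [integral_withDensity_eq_integral_toReal_smul (by fun_prop) (ae_of_all _ fun _ => by simp)]
    simp [ENNReal.toReal_ofReal']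
  have hm : (π.withDensity fun p => ENNReal.ofReal (d p)).map Prod.fst
      = (π.withDensity fun p => ENNReal.ofReal (-d p)).map Prod.fst := by
    have := hfin d hdi
    have := hfin (fun p => -d p) hdi.neg
    refine ext_of_forall_integral_eq_of_IsFiniteMeasure fun φ => ?_
    have hb : ∀ f : E × ℝ → ℝ, Integrable f π → Integrable (fun p => f p * φ p.1) π := fun f hf =>
      hf.mul_bdd (c := ‖φ‖) (φ.continuous.comp continuous_fst).aestronglyMeasurable
        (ae_of_all _ fun p => φ.norm_coe_le_norm p.1)
    rw [integral_map (by fun_prop) φ.continuous.aestronglyMeasurable,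
      integral_map (by fun_prop) φ.continuous.aestronglyMeasurable, hint d hdm,
      hint (fun p => -d p) hdm.neg, ← sub_eq_zero,
      ← integral_sub (hb _ hdi.pos_part) (hb (fun p => max (-d p) 0) hdi.neg.pos_part)]
    have h1 : ∀ p : E × ℝ, max (d p) 0 * φ p.1 - max (-d p) 0 * φ p.1
        = p.2 * φ p.1 - z p.1 * φ p.1 := by
      intro p
      rw [← sub_mul, ← sub_mul]
      congr 1
      exact max_zero_sub_max_neg_zero_eq_self (d p)
    rw [integral_congr_ae (ae_of_all _ h1), integral_sub (hb _ hi) (hb _ hz), h φ, sub_self]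
  refine (ae_eq_condExp_of_forall_setIntegral_eq measurable_fst.comap_le hi
    (fun s _ _ => hz.integrableOn) ?_ ?_).symm
  · rintro _ ⟨B, hB, rfl⟩ -
    have hB' : MeasurableSet (Prod.fst ⁻¹' B : Set (E × ℝ)) := measurable_fst hB
    have h1 : ∫ p in Prod.fst ⁻¹' B, d p ∂π = 0 := by
      have h2 := congrArg (fun m => m B) hm
      rw [Measure.map_apply measurable_fst hB, Measure.map_apply measurable_fst hB,
        withDensity_apply _ hB', withDensity_apply _ hB'] at h2
      rw [integral_eq_lintegral_pos_part_sub_lintegral_neg_part hdi.integrableOn, h2, sub_self]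
    rw [hd, integral_sub hi.integrableOn hz.integrableOn, sub_eq_zero] at h1
    exact h1.symm
  · exact ((hzm.comp (comap_measurable Prod.fst)).stronglyMeasurable).aestronglyMeasurable

/-- Strassen's theorem on the line, with covariates: if the call functions of `z` under `μ` are
dominated by those of `ν`, then some coupling of `μ` and `ν` has conditional mean `z`. -/
theorem exists_coupling_condExp_eq {μ : Measure E} [IsProbabilityMeasure μ]
    {ν : Measure ℝ} [IsProbabilityMeasure ν] (hν : Integrable (fun y : ℝ => y) ν)
    {z : E → ℝ} (hzm : Measurable z) (hz : Integrable z μ) (hmean : ∫ x, z x ∂μ = ∫ y, y ∂ν)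
    (hcall : ∀ k : ℝ, ∫ x, max (z x - k) 0 ∂μ ≤ ∫ y, max (y - k) 0 ∂ν) :
    ∃ π : Measure (E × ℝ), IsProbabilityMeasure π ∧ π.map Prod.fst = μ ∧ π.map Prod.snd = ν ∧
      π[fun p => p.2 | MeasurableSpace.comap Prod.fst inferInstance] =ᵐ[π] fun p => z p.1 := by
  obtain ⟨π, hπ, h⟩ := exists_coupling_integral_eq hν hz hmean hcall
  have hz' : Integrable (fun p : E × ℝ => z p.1) (π : Measure (E × ℝ)) := by
    rw [← hπ.1] at hz
    exact (integrable_map_measure (f := Prod.fst) hzm.aestronglyMeasurable (by fun_prop)).1 hz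
  refine ⟨π, inferInstance, hπ.1, hπ.2, condExp_fst_eq_of_integral_mul_eq
    (integrable_snd_of_mem_couplings hν hπ) hzm hz' fun φ => ?_⟩
  rw [h φ, ← hπ.1, integral_map (by fun_prop)
    (by fun_prop : Measurable fun x => z x * φ x).aestronglyMeasurable]

end Strassen

section ConvexOrder

open Set

/-- A convex function on the line decreases at most linearly. -/
theorem ConvexOn.exists_sub_mul_abs_le {φ : ℝ → ℝ} (hφ : ConvexOn ℝ univ φ) :
    ∃ C : ℝ, 0 ≤ C ∧ ∀ x, φ 0 - C * |x| ≤ φ x := by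
  refine ⟨|φ 0 - φ 1| + |φ 0 - φ (-1)|, by positivity, fun x => ?_⟩
  have key : ∀ e : ℝ, e ≠ 0 → ∀ r : ℝ, 0 ≤ r → (1 + r) * φ 0 ≤ φ (-(r * e)) + r * φ e := by
    intro e _ r hr
    have h1 : 0 < 1 + r := by linarith
    have h := hφ.2 (mem_univ (-(r * e))) (mem_univ e)
      (by positivity : (0 : ℝ) ≤ 1 / (1 + r)) (by positivity : (0 : ℝ) ≤ r / (1 + r))
      (by field_simp)
    have h0 : (1 / (1 + r)) • (-(r * e)) + (r / (1 + r)) • e = 0 := by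
      simp only [smul_eq_mul]; field_simp; ring
    rw [h0, smul_eq_mul, smul_eq_mul] at h
    calc (1 + r) * φ 0
        ≤ (1 + r) * (1 / (1 + r) * φ (-(r * e)) + r / (1 + r) * φ e) := by gcongr
      _ = φ (-(r * e)) + r * φ e := by field_simp
  rcases le_total 0 x with hx | hx
  · have h := key (-1) (by norm_num) x hx
    rw [abs_of_nonneg hx, show -(x * -1) = x by ring] at *
    nlinarith [neg_abs_le (φ 0 - φ (-1)), abs_nonneg (φ 0 - φ 1),
      mul_nonneg hx (abs_nonneg (φ 0 - φ 1)),
      mul_le_mul_of_nonneg_left (neg_abs_le (φ 0 - φ (-1))) hx]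
  · have h := key 1 one_ne_zero (-x) (by linarith)
    rw [abs_of_nonpos hx]
    rw [show -(-x * 1) = x by ring] at h
    nlinarith [mul_nonneg (neg_nonneg.2 hx) (abs_nonneg (φ 0 - φ (-1))),
      mul_le_mul_of_nonneg_left (neg_abs_le (φ 0 - φ 1)) (neg_nonneg.2 hx)]

theorem ConvexOn.continuous_of_univ {φ : ℝ → ℝ} (hφ : ConvexOn ℝ univ φ) : Continuous φ :=
  continuousOn_univ.1 (hφ.continuousOn isOpen_univ)

variable {Ω : Type*} [MeasurableSpace Ω] {P : Measure Ω}

theorem extExpectation_eq_integral {f : Ω → ℝ} (hf : Integrable f P) :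
    extExpectation P f = ((∫ ω, f ω ∂P : ℝ) : EReal) := by
  have h1 : ∫⁻ ω, ENNReal.ofReal (f ω) ∂P ≠ ⊤ := hf.lintegral_lt_top.ne
  have h2 : ∫⁻ ω, ENNReal.ofReal (-f ω) ∂P ≠ ⊤ := hf.neg.lintegral_lt_top.ne
  rw [extExpectation, integral_eq_lintegral_pos_part_sub_lintegral_neg_part hf, EReal.coe_sub,
    EReal.coe_ennreal_toReal h1, EReal.coe_ennreal_toReal h2]

theorem extExpectation_comp {f : Ω → ℝ} (hf : Measurable f) {φ : ℝ → ℝ} (hφ : Measurable φ) :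
    extExpectation P (fun ω => φ (f ω)) = extExpectation (P.map f) φ := by
  rw [extExpectation, extExpectation, lintegral_map (by fun_prop) hf,
    lintegral_map (by fun_prop) hf]

/-- Jensen's inequality for conditional expectations, with values in the extended reals. -/
theorem extExpectation_comp_condExp_le {Ω : Type*} {m m₀ : MeasurableSpace Ω} {P : Measure Ω}
    [IsProbabilityMeasure P] {Y Z : Ω → ℝ} (hY : Integrable Y P) (hm : m ≤ m₀)
    (hZ : P[Y | m] =ᵐ[P] Z) {φ : ℝ → ℝ} (hφ : ConvexOn ℝ univ φ) :
    extExpectation P (fun ω => φ (Z ω)) ≤ extExpectation P (fun ω => φ (Y ω)) := by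
  have hcont := hφ.continuous_of_univ
  obtain ⟨C, hC, hlow⟩ := hφ.exists_sub_mul_abs_le
  have hZi : Integrable Z P := integrable_condExp.congr hZ
  by_cases hφY : Integrable (fun ω => φ (Y ω)) P
  · have hJ := hφ.map_condExp_le_univ hm hcont.lowerSemicontinuous hY hφY
    have hle : ∀ᵐ ω ∂P, φ (Z ω) ≤ P[φ ∘ Y | m] ω := by
      filter_upwards [hJ, hZ] with ω h1 h2
      rw [← h2]
      exact h1
    have hφZ : Integrable (fun ω => φ (Z ω)) P := by
      refine integrable_of_le_of_le (hcont.comp_aestronglyMeasurable hZi.aestronglyMeasurable)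
        (ae_of_all _ fun ω => hlow (Z ω)) hle ((integrable_const _).sub (hZi.abs.const_mul C))
        integrable_condExp
    rw [extExpectation_eq_integral hφZ, extExpectation_eq_integral hφY, EReal.coe_le_coe_iff]
    calc ∫ ω, φ (Z ω) ∂P ≤ ∫ ω, P[φ ∘ Y | m] ω ∂P := integral_mono_ae hφZ integrable_condExp hle
      _ = ∫ ω, φ (Y ω) ∂P := integral_condExp hm
  · have hmeas : AEStronglyMeasurable (fun ω => φ (Y ω)) P :=
      hcont.comp_aestronglyMeasurable hY.aestronglyMeasurable
    have hneg : ∫⁻ ω, ENNReal.ofReal (-φ (Y ω)) ∂P ≠ ⊤ := by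
      have hi : Integrable (fun ω => C * |Y ω| - φ 0) P :=
        (hY.abs.const_mul C).sub (integrable_const _)
      refine ((lintegral_mono fun ω => ENNReal.ofReal_le_ofReal ?_).trans_lt
        hi.lintegral_lt_top).ne
      linarith [hlow (Y ω)]
    have hpos : ∫⁻ ω, ENNReal.ofReal (φ (Y ω)) ∂P = ⊤ := by
      by_contra hfin
      refine hφY ⟨hmeas, ?_⟩
      rw [hasFiniteIntegral_iff_norm]
      have hsplit : ∀ ω, ENNReal.ofReal ‖φ (Y ω)‖
          ≤ ENNReal.ofReal (φ (Y ω)) + ENNReal.ofReal (-φ (Y ω)) := by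
        intro ω
        rw [Real.norm_eq_abs]
        rcases abs_cases (φ (Y ω)) with h | h <;> rw [h.1]
        · exact le_self_add
        · exact le_add_self
      refine (lintegral_mono hsplit).trans_lt ?_
      rw [lintegral_add_left' hmeas.aemeasurable.ennreal_ofReal]
      exact ENNReal.add_lt_top.2 ⟨lt_top_iff_ne_top.2 hfin, lt_top_iff_ne_top.2 hneg⟩
    have htop : extExpectation P (fun ω => φ (Y ω)) = ⊤ := by
      rw [extExpectation, hpos, EReal.coe_ennreal_top]
      exact EReal.top_sub (by simpa using hneg)
    rw [htop]
    exact le_top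

theorem convexOn_call (k : ℝ) : ConvexOn ℝ univ fun x : ℝ => max (x - k) 0 :=
  ((convexOn_id convex_univ).sub (concaveOn_const k convex_univ)).sup (convexOn_const 0 convex_univ)

/-- Convex order implies domination of call functions. -/
theorem ConvexDominates.integral_call_le [IsFiniteMeasure P] {A B : Ω → ℝ}
    (h : ConvexDominates P A B) (k : ℝ) :
    ∫ ω, max (B ω - k) 0 ∂P ≤ ∫ ω, max (A ω - k) 0 ∂P := by
  have h1 := h.2.2 _ (convexOn_call k)
  rwa [extExpectation_eq_integral (integrable_call h.1 k),
    extExpectation_eq_integral (integrable_call h.2.1 k), EReal.coe_le_coe_iff] at h1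

/-- Convex order implies domination of second moments. -/
theorem ConvexDominates.integral_sq_le {A B : Ω → ℝ} (h : ConvexDominates P A B)
    (hA : MemLp A 2 P) (hB : MemLp B 2 P) : ∫ ω, B ω ^ 2 ∂P ≤ ∫ ω, A ω ^ 2 ∂P := by
  have h1 := h.2.2 _ (Even.convexOn_pow (n := 2) even_two)
  rwa [extExpectation_eq_integral hA.integrable_sq, extExpectation_eq_integral hB.integrable_sq,
    EReal.coe_le_coe_iff] at h1

end ConvexOrder

section Centering

variable {Ω : Type*} [MeasurableSpace Ω] {P : Measure Ω}
  {F : Type*} [NormedAddCommGroup F] [NormedSpace ℝ F]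

theorem memLp_centered [IsProbabilityMeasure P] {A : Ω → F} {r : ENNReal} (hA : MemLp A r P) :
    MemLp (centered P A) r P :=
  hA.sub (memLp_const _)

theorem integral_centered [CompleteSpace F] [IsProbabilityMeasure P] {A : Ω → F} (hA : Integrable A P) :
    ∫ ω, centered P A ω ∂P = 0 := by
  simp only [centered]
  rw [integral_sub hA (integrable_const _), integral_const, probReal_univ, one_smul, sub_self]

variable [MeasurableSpace F] [BorelSpace F]

theorem measurable_centered {A : Ω → F} (hA : Measurable A) :
    Measurable (centered P A) :=
  hA.sub_const _

variable [SecondCountableTopology F]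

/-- The law of a centered variable depends only on the law of the variable. -/
theorem map_centered {A : Ω → F} (hA : Measurable A) :
    P.map (centered P A) = (P.map A).map fun x => x - ∫ x', x' ∂(P.map A) := by
  rw [integral_map hA.aemeasurable (by fun_prop),
    Measure.map_map (by fun_prop) hA]
  rfl

theorem map_centered_eq_of_map_eq {Ω' : Type*} [MeasurableSpace Ω'] {P' : Measure Ω'}
    {A : Ω → F} {A' : Ω' → F} (hA : Measurable A) (hA' : Measurable A')
    (h : P'.map A' = P.map A) : P'.map (centered P' A') = P.map (centered P A) := by
  rw [map_centered hA, map_centered hA', h]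

end Centering

section CallSet

open Set

variable {Ω : Type*} [MeasurableSpace Ω] {P : Measure Ω}
  {F : Type*} [NormedAddCommGroup F] [InnerProductSpace ℝ F]

/-- The directions `β` along which the call functions of `U` are dominated by those of `V`. -/
def callSet (P : Measure Ω) (U : Ω → F) (V : Ω → ℝ) : Set F :=
  {β | ∀ k : ℝ, ∫ ω, max (inner ℝ (U ω) β - k) 0 ∂P ≤ ∫ ω, max (V ω - k) 0 ∂P}

theorem convexOn_integral_call [IsFiniteMeasure P] {U : Ω → F} (hU : Integrable U P) (k : ℝ) :
    ConvexOn ℝ univ fun β : F => ∫ ω, max (inner ℝ (U ω) β - k) 0 ∂P := by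
  refine ⟨convex_univ, fun β _ γ _ a b ha hb hab => ?_⟩
  have hi : ∀ δ : F, Integrable (fun ω => max (inner ℝ (U ω) δ - k) 0) P := fun δ =>
    integrable_call (hU.inner_const δ) k
  simp only [smul_eq_mul]
  rw [← integral_const_mul, ← integral_const_mul,
    ← integral_add ((hi β).const_mul a) ((hi γ).const_mul b)]
  refine integral_mono (hi _) (((hi β).const_mul a).add ((hi γ).const_mul b)) fun ω => ?_
  have h := (convexOn_call k).2 (mem_univ (inner ℝ (U ω) β)) (mem_univ (inner ℝ (U ω) γ)) ha hb hab
  simpa only [inner_add_right, inner_smul_right, smul_eq_mul] using h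

theorem convex_callSet [IsFiniteMeasure P] {U : Ω → F} (hU : Integrable U P) (V : Ω → ℝ) :
    Convex ℝ (callSet P U V) := by
  have h : callSet P U V = ⋂ k : ℝ, {β ∈ univ | ∫ ω, max (inner ℝ (U ω) β - k) 0 ∂P
      ≤ ∫ ω, max (V ω - k) 0 ∂P} := by
    ext β
    simp [callSet]
  rw [h]
  exact convex_iInter fun k => (convexOn_integral_call hU k).convex_le _

theorem isClosed_callSet [FiniteDimensional ℝ F] [IsFiniteMeasure P] {U : Ω → F}
    (hU : Integrable U P) (V : Ω → ℝ) : IsClosed (callSet P U V) := by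
  have h : callSet P U V = ⋂ k : ℝ, {β | ∫ ω, max (inner ℝ (U ω) β - k) 0 ∂P
      ≤ ∫ ω, max (V ω - k) 0 ∂P} := by
    ext β
    simp [callSet]
  rw [h]
  exact isClosed_iInter fun k => isClosed_le
    (continuousOn_univ.1 ((convexOn_integral_call hU k).continuousOn isOpen_univ)) continuous_const

theorem zero_mem_callSet [IsProbabilityMeasure P] (U : Ω → F) {V : Ω → ℝ} (hV : Integrable V P)
    (hV0 : ∫ ω, V ω ∂P = 0) : (0 : F) ∈ callSet P U V := by
  intro k
  simp only [inner_zero_right, zero_sub, integral_const, probReal_univ, one_smul]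
  refine max_le ?_ (integral_nonneg fun ω => le_max_right _ _)
  have h : ∫ ω, (V ω - k) ∂P ≤ ∫ ω, max (V ω - k) 0 ∂P :=
    integral_mono (hV.sub (integrable_const k)) (integrable_call hV k) fun ω => le_max_left _ _
  rw [integral_sub hV (integrable_const k), hV0] at h
  simpa using h

theorem integral_call_map {A : Ω → ℝ} (hA : Measurable A) (k : ℝ) :
    ∫ y, max (y - k) 0 ∂(P.map A) = ∫ ω, max (A ω - k) 0 ∂P :=
  integral_map hA.aemeasurable (by fun_prop)

end CallSet

section Superquantile

open Set

variable {Ω : Type*} [MeasurableSpace Ω] {P : Measure Ω} [IsProbabilityMeasure P]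

theorem cdfOf_eq_cdf {P : Measure Ω} (A : Ω → ℝ) : cdfOf P A = cdf (P.map A) := rfl

theorem cdfOf_const_mul {A : Ω → ℝ} (hA : Measurable A) {l : ℝ} (hl : 0 < l) :
    cdfOf P (fun ω => l * A ω) = fun x => cdfOf P A (x / l) := by
  have h1 : IsProbabilityMeasure (P.map A) := Measure.isProbabilityMeasure_map hA.aemeasurable
  have h2 : IsProbabilityMeasure (P.map fun ω => l * A ω) :=
    Measure.isProbabilityMeasure_map (hA.const_mul l).aemeasurable
  ext x
  simp only [cdfOf]
  rw [cdf_eq_real, cdf_eq_real, map_measureReal_apply (hA.const_mul l) measurableSet_Iic,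
    map_measureReal_apply hA measurableSet_Iic]
  congr 1
  ext ω
  simp only [mem_preimage, mem_Iic]
  rw [le_div_iff₀ hl, mul_comm]

/-- Domination of call functions of centered variables, in terms of superquantiles. -/
theorem call_le_iff_superquantile_le {A B : Ω → ℝ} (hA : Measurable A) (hB : Measurable B)
    (hAi : Integrable A P) (hBi : Integrable B P) (hA0 : ∫ ω, A ω ∂P = 0)
    (hB0 : ∫ ω, B ω ∂P = 0) :
    (∀ k : ℝ, ∫ ω, max (B ω - k) 0 ∂P ≤ ∫ ω, max (A ω - k) 0 ∂P) ↔
      ∀ α ∈ Ioo (0 : ℝ) 1,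
        ∫ t in α..1, genInv (cdfOf P B) t ≤ ∫ t in α..1, genInv (cdfOf P A) t := by
  have h1 : IsProbabilityMeasure (P.map A) := Measure.isProbabilityMeasure_map hA.aemeasurable
  have h2 : IsProbabilityMeasure (P.map B) := Measure.isProbabilityMeasure_map hB.aemeasurable
  simp only [cdfOf_eq_cdf, ← integral_call_map hA, ← integral_call_map hB]
  refine call_le_iff_integral_genInv_cdf_le
    ((integrable_map_measure (by fun_prop) hB.aemeasurable).2 hBi)
    ((integrable_map_measure (by fun_prop) hA.aemeasurable).2 hAi) ?_
  rw [integral_map hA.aemeasurable (by fun_prop), integral_map hB.aemeasurable (by fun_prop),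
    hA0, hB0]

theorem superquantile_pos {A : Ω → ℝ} (hA : Measurable A) (hAi : Integrable A P)
    (hA0 : ∫ ω, A ω ∂P = 0) (hne : ¬ ∀ᵐ ω ∂P, A ω = 0) {α : ℝ} (hα : α ∈ Ioo (0 : ℝ) 1) :
    0 < ∫ t in α..1, genInv (cdfOf P A) t := by
  have h1 : IsProbabilityMeasure (P.map A) := Measure.isProbabilityMeasure_map hA.aemeasurable
  refine integral_genInv_cdf_pos ((integrable_map_measure (by fun_prop) hA.aemeasurable).2 hAi)
    ?_ (fun h => hne (ae_of_ae_map hA.aemeasurable h)) hα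
  rw [integral_map hA.aemeasurable (by fun_prop), hA0]

/-- A scaled variable has dominated call functions exactly when the scale is at most the infimum of
the superquantile ratios. -/
theorem call_const_mul_le_iff_le_infRatio {A B : Ω → ℝ} (hA : Measurable A) (hB : Measurable B)
    (hAi : Integrable A P) (hBi : Integrable B P) (hA0 : ∫ ω, A ω ∂P = 0)
    (hB0 : ∫ ω, B ω ∂P = 0) (hAne : ¬ ∀ᵐ ω ∂P, A ω = 0) (hBne : ¬ ∀ᵐ ω ∂P, B ω = 0)
    {l : ℝ} (hl : 0 < l) :
    (∀ k : ℝ, ∫ ω, max (l * B ω - k) 0 ∂P ≤ ∫ ω, max (A ω - k) 0 ∂P) ↔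
      l ≤ infRatio (cdfOf P A) (cdfOf P B) := by
  have hne : Nonempty (Ioo (0 : ℝ) 1) := ⟨⟨1 / 2, by norm_num, by norm_num⟩⟩
  have hbdd : BddBelow (range fun α : Ioo (0 : ℝ) 1 =>
      superquantileRatio (α : ℝ) (cdfOf P A) (cdfOf P B)) := by
    refine ⟨0, ?_⟩
    rintro _ ⟨α, rfl⟩
    exact div_nonneg (superquantile_pos hA hAi hA0 hAne α.2).le
      (superquantile_pos hB hBi hB0 hBne α.2).le
  rw [call_le_iff_superquantile_le hA (hB.const_mul l) hAi (hBi.const_mul l) hA0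
    (by rw [integral_const_mul, hB0, mul_zero]), infRatio, le_ciInf_iff hbdd, Subtype.forall]
  refine forall₂_congr fun α hα => ?_
  rw [superquantileRatio, le_div_iff₀ (superquantile_pos hB hBi hB0 hBne hα),
    cdfOf_const_mul hB hl]
  simp only [genInv_comp_div _ hl, intervalIntegral.integral_const_mul]

theorem infRatio_nonneg {A B : Ω → ℝ} (hA : Measurable A) (hB : Measurable B)
    (hAi : Integrable A P) (hBi : Integrable B P) (hA0 : ∫ ω, A ω ∂P = 0)
    (hB0 : ∫ ω, B ω ∂P = 0) (hAne : ¬ ∀ᵐ ω ∂P, A ω = 0) (hBne : ¬ ∀ᵐ ω ∂P, B ω = 0) :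
    0 ≤ infRatio (cdfOf P A) (cdfOf P B) :=
  Real.iInf_nonneg fun α => div_nonneg (superquantile_pos hA hAi hA0 hAne α.2).le
    (superquantile_pos hB hBi hB0 hBne α.2).le

/-- The polar representation of the set of directions with dominated call functions. -/
theorem callSet_eq_setOf_smul {F : Type*} [NormedAddCommGroup F] [InnerProductSpace ℝ F]
    [Nontrivial F] [MeasurableSpace F] [BorelSpace F] [SecondCountableTopology F] [CompleteSpace F]
    {U : Ω → F} {V : Ω → ℝ} (hU : Measurable U) (hV : Measurable V) (hUi : Integrable U P)
    (hVi : Integrable V P) (hU0 : ∫ ω, U ω ∂P = 0) (hV0 : ∫ ω, V ω ∂P = 0)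
    (hVne : ¬ ∀ᵐ ω ∂P, V ω = 0) (hUne : ∀ q : F, q ≠ 0 → ¬ ∀ᵐ ω ∂P, inner ℝ (U ω) q = 0) :
    callSet P U V = {β | ∃ q ∈ Metric.sphere (0 : F) 1, ∃ l : ℝ, 0 ≤ l ∧
      l ≤ infRatio (cdfOf P V) (cdfOf P fun ω => inner ℝ (U ω) q) ∧ β = l • q} := by
  have hm : ∀ q : F, Measurable fun ω => inner ℝ (U ω) q := fun q => by fun_prop
  have hi : ∀ q : F, Integrable (fun ω => inner ℝ (U ω) q) P := fun q => hUi.inner_const q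
  have h0 : ∀ q : F, ∫ ω, inner ℝ (U ω) q ∂P = 0 := fun q => by
    simp_rw [real_inner_comm q]
    rw [integral_inner hUi q, hU0, inner_zero_right]
  have hq0 : ∀ q ∈ Metric.sphere (0 : F) 1, q ≠ 0 := fun q hq =>
    ne_zero_of_mem_unit_sphere (⟨q, hq⟩ : Metric.sphere (0 : F) 1)
  have key : ∀ q ∈ Metric.sphere (0 : F) 1, ∀ l : ℝ, 0 < l → (l • q ∈ callSet P U V ↔
      l ≤ infRatio (cdfOf P V) (cdfOf P fun ω => inner ℝ (U ω) q)) := by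
    intro q hq l hl
    rw [← call_const_mul_le_iff_le_infRatio hV (hm q) hVi (hi q) hV0 (h0 q) hVne
      (hUne q (hq0 q hq)) hl]
    simp only [callSet, mem_ofPred_eq, inner_smul_right]
  ext β
  constructor
  · intro hβ
    by_cases hβ0 : β = 0
    · obtain ⟨q, hq⟩ := NormedSpace.sphere_nonempty (x := (0 : F)).2 zero_le_one
      exact ⟨q, hq, 0, le_rfl, infRatio_nonneg hV (hm q) hVi (hi q) hV0 (h0 q) hVne
        (hUne q (hq0 q hq)), by rw [hβ0, zero_smul]⟩
    · have hn : 0 < ‖β‖ := norm_pos_iff.2 hβ0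
      have hq : ‖β‖⁻¹ • β ∈ Metric.sphere (0 : F) 1 := by
        rw [mem_sphere_zero_iff_norm, norm_smul, norm_inv, norm_norm, inv_mul_cancel₀ hn.ne']
      have hβq : β = ‖β‖ • (‖β‖⁻¹ • β) := by rw [smul_inv_smul₀ hn.ne']
      refine ⟨_, hq, ‖β‖, hn.le, (key _ hq _ hn).1 ?_, hβq⟩
      rwa [← hβq]
  · rintro ⟨q, hq, l, hl0, hl, rfl⟩
    rcases hl0.eq_or_lt with h | h
    · rw [← h, zero_smul]
      exact zero_mem_callSet U hVi hV0
    · exact (key q hq l h).2 hl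

end Superquantile

section IdentifiedSet

open Set

variable {Ω : Type*} [MeasurableSpace Ω] {P : Measure Ω} [IsProbabilityMeasure P] {p : ℕ}
  {X : Ω → EuclideanSpace ℝ (Fin p)} {Y : Ω → ℝ}

theorem convexDominates_of_mem_identifiedSet (hX : Measurable X) (hY : Measurable Y)
    (hXi : Integrable X P) (hYi : Integrable Y P) {β : EuclideanSpace ℝ (Fin p)}
    (hβ : β ∈ identifiedSet (P.map Y) (P.map X)) :
    ConvexDominates P (centered P Y) (fun ω => inner ℝ (centered P X ω) β) := by
  obtain ⟨Ω', _, P', X', Y', hP', hX', hY', hXX, hYY, hcond⟩ := hβ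
  refine ⟨hYi.sub (integrable_const _),
    (hXi.sub (integrable_const _) : Integrable (centered P X) P).inner_const β, fun φ hφ => ?_⟩
  have hφm : Measurable φ := hφ.continuous_of_univ.measurable
  have hY'i : Integrable Y' P' := by
    have : Integrable (fun y : ℝ => y) (P.map Y) :=
      (integrable_map_measure (by fun_prop) hY.aemeasurable).2 hYi
    rw [← hYY] at this
    exact (integrable_map_measure (by fun_prop) hY'.aemeasurable).1 this
  have hinner : Measurable fun x : EuclideanSpace ℝ (Fin p) => inner ℝ x β := by fun_prop
  have hcX := measurable_centered (P := P) hX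
  have hcX' := measurable_centered (P := P') hX'
  have h1 : P'.map (fun ω => inner ℝ (centered P' X' ω) β)
      = P.map fun ω => inner ℝ (centered P X ω) β := by
    have h2 := congrArg (Measure.map fun x : EuclideanSpace ℝ (Fin p) => inner ℝ x β)
      (map_centered_eq_of_map_eq hX hX' hXX)
    rwa [Measure.map_map hinner hcX', Measure.map_map hinner hcX] at h2
  calc extExpectation P (fun ω => φ (inner ℝ (centered P X ω) β))
      = extExpectation P' (fun ω => φ (inner ℝ (centered P' X' ω) β)) := by
        rw [extExpectation_comp (f := fun ω => inner ℝ (centered P X ω) β) (hinner.comp hcX) hφm,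
          extExpectation_comp (f := fun ω => inner ℝ (centered P' X' ω) β) (hinner.comp hcX') hφm,
          h1]
    _ ≤ extExpectation P' (fun ω => φ (centered P' Y' ω)) :=
        extExpectation_comp_condExp_le (hY'i.sub (integrable_const _)) hcX'.comap_le hcond hφ
    _ = extExpectation P (fun ω => φ (centered P Y ω)) := by
        rw [extExpectation_comp (measurable_centered hY) hφm,
          extExpectation_comp (measurable_centered hY') hφm, map_centered_eq_of_map_eq hY hY' hYY]

theorem callSet_subset_identifiedSet (hX : Measurable X) (hY : Measurable Y)
    (hXi : Integrable X P) (hYi : Integrable Y P) :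
    callSet P (centered P X) (centered P Y) ⊆ identifiedSet (P.map Y) (P.map X) := by
  intro β hβ
  have hcX := measurable_centered (P := P) hX
  have hcY := measurable_centered (P := P) hY
  have hcXi : Integrable (centered P X) P := hXi.sub (integrable_const _)
  have hcYi : Integrable (centered P Y) P := hYi.sub (integrable_const _)
  have hμ : IsProbabilityMeasure (P.map (centered P X)) :=
    Measure.isProbabilityMeasure_map hcX.aemeasurable
  have hν : IsProbabilityMeasure (P.map (centered P Y)) :=
    Measure.isProbabilityMeasure_map hcY.aemeasurable
  have hμi : Integrable (fun x => x) (P.map (centered P X)) :=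
    (integrable_map_measure (by fun_prop) hcX.aemeasurable).2 hcXi
  have hνi : Integrable (fun y : ℝ => y) (P.map (centered P Y)) :=
    (integrable_map_measure (by fun_prop) hcY.aemeasurable).2 hcYi
  have hμ0 : ∫ x, x ∂(P.map (centered P X)) = 0 := by
    rw [integral_map hcX.aemeasurable (by fun_prop), integral_centered hXi]
  have hν0 : ∫ y, y ∂(P.map (centered P Y)) = 0 := by
    rw [integral_map hcY.aemeasurable (by fun_prop), integral_centered hYi]
  have hz0 : ∫ x, inner ℝ x β ∂(P.map (centered P X)) = 0 := by
    simp_rw [real_inner_comm β]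
    rw [integral_inner hμi β, hμ0, inner_zero_right]
  obtain ⟨π, hπ, hπ1, hπ2, hcond⟩ := exists_coupling_condExp_eq
    (μ := P.map (centered P X)) (ν := P.map (centered P Y)) hνi
    (z := fun x => inner ℝ x β) (by fun_prop) (hμi.inner_const β) (by rw [hz0, hν0])
    (fun k => by
      rw [integral_call_map hcY, integral_map hcX.aemeasurable (by fun_prop)]
      exact hβ k)
  have hfst : Integrable (fun q : EuclideanSpace ℝ (Fin p) × ℝ => q.1) π := by
    rw [← hπ1] at hμi
    exact (integrable_map_measure (f := Prod.fst) (by fun_prop) (by fun_prop)).1 hμi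
  have hsnd : Integrable (fun q : EuclideanSpace ℝ (Fin p) × ℝ => q.2) π := by
    rw [← hπ2] at hνi
    exact (integrable_map_measure (f := Prod.snd) (by fun_prop) (by fun_prop)).1 hνi
  have hfst0 : ∫ q, q.1 ∂π = 0 := by
    rw [← hπ1, integral_map (by fun_prop) (by fun_prop)] at hμ0
    exact hμ0
  have hsnd0 : ∫ q, q.2 ∂π = 0 := by
    rw [← hπ2, integral_map (by fun_prop) (by fun_prop)] at hν0
    exact hν0
  have hcent1 : centered π (fun q => q.1 + ∫ ω, X ω ∂P) = Prod.fst := by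
    ext1 q
    simp only [centered]
    rw [integral_add hfst (integrable_const _), hfst0]
    simp
  have hcent2 : centered π (fun q => q.2 + ∫ ω, Y ω ∂P) = fun q => q.2 := by
    ext1 q
    simp only [centered]
    rw [integral_add hsnd (integrable_const _), hsnd0]
    simp
  refine ⟨EuclideanSpace ℝ (Fin p) × ℝ, inferInstance, π, fun q => q.1 + ∫ ω, X ω ∂P,
    fun q => q.2 + ∫ ω, Y ω ∂P, hπ, by fun_prop, by fun_prop, ?_, ?_, ?_⟩
  · have h := congrArg (Measure.map fun x => x + ∫ ω, X ω ∂P) hπ1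
    rw [Measure.map_map (by fun_prop) (by fun_prop), Measure.map_map (by fun_prop) hcX] at h
    refine h.trans ?_
    congr 1
    ext1 ω
    simp [centered]
  · have h := congrArg (Measure.map fun y => y + ∫ ω, Y ω ∂P) hπ2
    rw [Measure.map_map (by fun_prop) (by fun_prop), Measure.map_map (by fun_prop) hcY] at h
    refine h.trans ?_
    congr 1
    ext1 ω
    simp [centered]
  · rw [hcent1, hcent2]
    exact hcond

theorem identifiedSet_eq_setOf_convexDominates (hX : Measurable X) (hY : Measurable Y)
    (hXi : Integrable X P) (hYi : Integrable Y P) :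
    identifiedSet (P.map Y) (P.map X)
      = {β | ConvexDominates P (centered P Y) (fun ω => inner ℝ (centered P X ω) β)} :=
  Subset.antisymm (fun _ hβ => convexDominates_of_mem_identifiedSet hX hY hXi hYi hβ)
    fun _ hβ => callSet_subset_identifiedSet hX hY hXi hYi fun k => hβ.integral_call_le k

theorem identifiedSet_eq_callSet (hX : Measurable X) (hY : Measurable Y)
    (hXi : Integrable X P) (hYi : Integrable Y P) :
    identifiedSet (P.map Y) (P.map X) = callSet P (centered P X) (centered P Y) :=
  Subset.antisymm
    (fun _ hβ k => (convexDominates_of_mem_identifiedSet hX hY hXi hYi hβ).integral_call_le k)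
    (callSet_subset_identifiedSet hX hY hXi hYi)

end IdentifiedSet

section Covariance

open Set Matrix

variable {Ω : Type*} [MeasurableSpace Ω] {P : Measure Ω} [IsProbabilityMeasure P] {p : ℕ}
  {X : Ω → EuclideanSpace ℝ (Fin p)}

theorem centered_apply_eq {P : Measure Ω} (hXi : Integrable X P) (ω : Ω) (i : Fin p) :
    centered P X ω i = X ω i - ∫ ω', X ω' i ∂P := by
  have h := (EuclideanSpace.proj (𝕜 := ℝ) i).integral_comp_comm hXi
  change ∫ ω', X ω' i ∂P = (∫ ω', X ω' ∂P) i at h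
  simp [centered, h]

theorem memLp_coord (hX2 : MemLp X 2 P) (i : Fin p) : MemLp (fun ω => centered P X ω i) 2 P :=
  (EuclideanSpace.proj (𝕜 := ℝ) i).comp_memLp' (memLp_centered hX2)

theorem covMatrix_mulVec_apply (hX2 : MemLp X 2 P) (β : EuclideanSpace ℝ (Fin p)) (i : Fin p) :
    (covMatrix P X *ᵥ β.ofLp) i
      = ∫ ω, centered P X ω i * inner ℝ (centered P X ω) β ∂P := by
  have hXi : Integrable X P := hX2.integrable (by norm_num)
  have h1 : ∀ j, Integrable (fun ω => centered P X ω i * centered P X ω j * β j) P := fun j =>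
    ((memLp_coord hX2 i).integrable_mul (memLp_coord hX2 j)).mul_const _
  have h2 : ∀ ω, centered P X ω i * inner ℝ (centered P X ω) β
      = ∑ j, centered P X ω i * centered P X ω j * β j := by
    intro ω
    rw [PiLp.inner_apply, Finset.mul_sum]
    refine Finset.sum_congr rfl fun j _ => ?_
    simp only [RCLike.inner_apply, conj_trivial]
    ring
  rw [integral_congr_ae (ae_of_all _ h2), integral_finsetSum _ fun j _ => h1 j]
  change ∑ j, covMatrix P X i j * β j = _
  refine Finset.sum_congr rfl fun j _ => ?_
  rw [integral_mul_const]
  congr 1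
  simp only [covMatrix, of_apply, covariance, centered_apply_eq hXi]

theorem dotProduct_covMatrix_mulVec (hX2 : MemLp X 2 P) (β : EuclideanSpace ℝ (Fin p)) :
    β.ofLp ⬝ᵥ (covMatrix P X *ᵥ β.ofLp) = ∫ ω, inner ℝ (centered P X ω) β ^ 2 ∂P := by
  have hinner : MemLp (fun ω => inner ℝ (centered P X ω) β) 2 P :=
    (memLp_centered hX2).inner_const β
  simp only [dotProduct, covMatrix_mulVec_apply hX2, ← integral_const_mul]
  have hi : ∀ i, Integrable (fun ω => β i * (centered P X ω i * inner ℝ (centered P X ω) β)) P :=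
    fun i => ((memLp_coord hX2 i).integrable_mul hinner).const_mul (β i)
  rw [← integral_finsetSum _ fun i _ => hi i]
  refine integral_congr_ae (ae_of_all _ fun ω => ?_)
  have hs : inner ℝ (centered P X ω) β = ∑ i, β i * centered P X ω i := by
    rw [PiLp.inner_apply]
    exact Finset.sum_congr rfl fun j _ => by simp
  calc ∑ i, β i * (centered P X ω i * inner ℝ (centered P X ω) β)
      = (∑ i, β i * centered P X ω i) * inner ℝ (centered P X ω) β := by
        rw [Finset.sum_mul]
        exact Finset.sum_congr rfl fun j _ => by ring
    _ = inner ℝ (centered P X ω) β ^ 2 := by rw [← hs, sq]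

theorem not_ae_inner_centered_eq_zero (hX2 : MemLp X 2 P) (hV : (covMatrix P X).det ≠ 0)
    {q : EuclideanSpace ℝ (Fin p)} (hq : q ≠ 0) :
    ¬ ∀ᵐ ω ∂P, inner ℝ (centered P X ω) q = 0 := by
  intro h
  have h1 : covMatrix P X *ᵥ q.ofLp = 0 := by
    ext i
    rw [covMatrix_mulVec_apply hX2]
    refine integral_eq_zero_of_ae ?_
    filter_upwards [h] with ω hω
    simp [hω]
  have h2 := Matrix.eq_zero_of_mulVec_eq_zero hV h1
  exact hq (by ext i; simpa using congrFun h2 i)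

theorem isBounded_setOf_covMatrix_le (hX2 : MemLp X 2 P) (hV : (covMatrix P X).det ≠ 0) (v : ℝ) :
    Bornology.IsBounded {β : EuclideanSpace ℝ (Fin p) |
      β.ofLp ⬝ᵥ (covMatrix P X *ᵥ β.ofLp) ≤ v} := by
  set Q : EuclideanSpace ℝ (Fin p) → ℝ := fun β => β.ofLp ⬝ᵥ (covMatrix P X *ᵥ β.ofLp) with hQ
  have hpos : ∀ β, β ≠ 0 → 0 < Q β := by
    intro β hβ
    rw [hQ]
    simp only [dotProduct_covMatrix_mulVec hX2]
    refine (integral_nonneg fun ω => sq_nonneg _).lt_of_ne fun h0 =>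
      not_ae_inner_centered_eq_zero hX2 hV hβ ?_
    have h1 := (integral_eq_zero_iff_of_nonneg (fun ω => sq_nonneg _)
      ((memLp_centered hX2).inner_const β).integrable_sq).1 h0.symm
    filter_upwards [h1] with ω hω
    exact pow_eq_zero_iff two_ne_zero |>.1 hω
  have hhom : ∀ (c : ℝ) β, Q (c • β) = c ^ 2 * Q β := by
    intro c β
    simp only [hQ, WithLp.ofLp_smul, mulVec_smul, smul_dotProduct, dotProduct_smul, smul_eq_mul]
    ring
  have hcont : Continuous Q := by
    simp only [hQ, dotProduct, mulVec]
    fun_prop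
  rcases (Metric.sphere (0 : EuclideanSpace ℝ (Fin p)) 1).eq_empty_or_nonempty with hs | hs
  · refine (Bornology.isBounded_singleton (x := (0 : EuclideanSpace ℝ (Fin p)))).subset
      fun β _ => ?_
    by_contra hβ
    have : ‖β‖⁻¹ • β ∈ Metric.sphere (0 : EuclideanSpace ℝ (Fin p)) 1 := by
      rw [mem_sphere_zero_iff_norm, norm_smul, norm_inv, norm_norm,
        inv_mul_cancel₀ (norm_ne_zero_iff.2 hβ)]
    rw [hs] at this
    exact this
  obtain ⟨q, hq, hmin⟩ := (isCompact_sphere (0 : EuclideanSpace ℝ (Fin p)) 1).exists_isMinOn hs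
    hcont.continuousOn
  have hq0 : 0 < Q q := hpos q (ne_zero_of_mem_unit_sphere
    (⟨q, hq⟩ : Metric.sphere (0 : EuclideanSpace ℝ (Fin p)) 1))
  refine (Metric.isBounded_closedBall (x := (0 : EuclideanSpace ℝ (Fin p)))
    (r := Real.sqrt (v / Q q))).subset fun β hβ => ?_
  rw [mem_closedBall_zero_iff]
  by_cases hβ0 : β = 0
  · rw [hβ0, norm_zero]
    exact Real.sqrt_nonneg _
  have hn : ‖β‖ ≠ 0 := norm_ne_zero_iff.2 hβ0
  have hu : ‖β‖⁻¹ • β ∈ Metric.sphere (0 : EuclideanSpace ℝ (Fin p)) 1 := by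
    rw [mem_sphere_zero_iff_norm, norm_smul, norm_inv, norm_norm, inv_mul_cancel₀ hn]
  have h1 : Q q ≤ Q (‖β‖⁻¹ • β) := hmin hu
  have h2 : Q β = ‖β‖ ^ 2 * Q (‖β‖⁻¹ • β) := by rw [← hhom, smul_inv_smul₀ hn]
  refine Real.le_sqrt_of_sq_le ((le_div_iff₀ hq0).2 ?_)
  have h3 : Q β ≤ v := hβ
  exact (mul_le_mul_of_nonneg_left h1 (sq_nonneg _)).trans (h2 ▸ h3)

end Covariance

end

theorem theorem1 {Ω : Type*} [MeasurableSpace Ω] (P : Measure Ω) [IsProbabilityMeasure P]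
    {p : ℕ} (hp : 1 ≤ p)
    (X : Ω → EuclideanSpace ℝ (Fin p)) (Y : Ω → ℝ)
    (hX : Measurable X) (hY : Measurable Y)
    (hX2 : MemLp X 2 P) (hY2 : MemLp Y 2 P)
    (hVY : 0 < variance Y P)
    (hVX : (covMatrix P X).det ≠ 0)
    (α₀ : ℝ) (β₀ : EuclideanSpace ℝ (Fin p))
    (hlin : P[Y | MeasurableSpace.comap X inferInstance]
      =ᵐ[P] fun ω => α₀ + inner ℝ (X ω) β₀) :
    identifiedSet (P.map Y) (P.map X) =
      {β | ∃ q ∈ Metric.sphere (0 : EuclideanSpace ℝ (Fin p)) 1, ∃ l : ℝ,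
        0 ≤ l ∧
        l ≤ infRatio (cdfOf P (centered P Y))
          (cdfOf P (fun ω => inner ℝ (centered P X ω) q)) ∧
        β = l • q} ∧
    identifiedSet (P.map Y) (P.map X) =
      {β | ConvexDominates P (centered P Y) (fun ω => inner ℝ (centered P X ω) β)} ∧
    (0 : EuclideanSpace ℝ (Fin p)) ∈ identifiedSet (P.map Y) (P.map X) ∧
    Convex ℝ (identifiedSet (P.map Y) (P.map X)) ∧
    IsCompact (identifiedSet (P.map Y) (P.map X)) ∧
    identifiedSet (P.map Y) (P.map X) ⊆
      {β | β.ofLp ⬝ᵥ ((covMatrix P X).mulVec β.ofLp) ≤ variance Y P} := by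
  have hXi : Integrable X P := hX2.integrable (by norm_num)
  have hYi : Integrable Y P := hY2.integrable (by norm_num)
  have hcXi : Integrable (centered P X) P := hXi.sub (integrable_const _)
  have hcYi : Integrable (centered P Y) P := hYi.sub (integrable_const _)
  have hvar : variance Y P = ∫ ω, centered P Y ω ^ 2 ∂P := variance_eq_integral hY.aemeasurable
  have hYne : ¬ ∀ᵐ ω ∂P, centered P Y ω = 0 := by
    intro h
    rw [hvar, integral_eq_zero_of_ae] at hVY
    · exact hVY.false
    · filter_upwards [h] with ω hω
      simp [hω]
  have hcall := identifiedSet_eq_callSet hX hY hXi hYi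
  have hdom := identifiedSet_eq_setOf_convexDominates hX hY hXi hYi
  have hquad : identifiedSet (P.map Y) (P.map X) ⊆
      {β | β.ofLp ⬝ᵥ ((covMatrix P X).mulVec β.ofLp) ≤ variance Y P} := by
    intro β hβ
    rw [hdom] at hβ
    change β.ofLp ⬝ᵥ ((covMatrix P X).mulVec β.ofLp) ≤ variance Y P
    rw [dotProduct_covMatrix_mulVec hX2, hvar]
    exact hβ.integral_sq_le (memLp_centered hY2) ((memLp_centered hX2).inner_const β)
  have hp0 : Nonempty (Fin p) := ⟨⟨0, hp⟩⟩
  refine ⟨?_, hdom, ?_, ?_, ?_, hquad⟩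
  · rw [hcall]
    exact callSet_eq_setOf_smul (measurable_centered hX) (measurable_centered hY) hcXi hcYi
      (integral_centered hXi) (integral_centered hYi) hYne
      fun q hq => not_ae_inner_centered_eq_zero hX2 hVX hq
  · rw [hcall]
    exact zero_mem_callSet _ hcYi (integral_centered hYi)
  · rw [hcall]
    exact convex_callSet hcXi _
  · refine Metric.isCompact_of_isClosed_isBounded ?_
      ((isBounded_setOf_covMatrix_le hX2 hVX _).subset hquad)
    rw [hcall]
    exact isClosed_callSet hcXi _
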